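/- Let $d\ge 1$ and $n\ge d$ be natural numbers. A point set is $X=(x_1,\dots,x_n)\in\mathbb R^{d\times n}$ with columns $x_j\in\mathbb R^d$, and $\|X\|_F$ is its Frobenius norm. Centralizing $X$ means replacing each $x_j$ by $x_j-\frac1n\sum_l x_l$; $X$ is centralized if $\sum_l x_l=0$. Let $$d_{\mathcal G_+}(X,Y)=\min_{\pi\in S_n,\;R\in SO(d),\;t\in\mathbb R^d}\Big(\sum_{j=1}^n\|x_j-(Ry_{\pi(j)}+t)\|_2^2\Big)^{1/2}.$$ Let $T(n,d-1)$ be the set of all $(d-1)$-tuples $\mathbf i=(i_1,\dots,i_{d-1})$ of pairwise distinct elements of $[n]=\{1,\dots,n\}$. For $\mathbf i\in T(n,d-1)$ let $x_{\mathbf i}^\perp\in\mathbb R^d$ be the generalized cross product (Hodge dual of $x_{i_1}\wedge\dots\wedge x_{i_{d-1}}$), i.e. the unique vector with $\langle x_{\mathbf i}^\perp,y\rangle=\det(x_{i_1}\,\cdots\,x_{i_{d-1}}\;y)$ for all $y\in\mathbb R^d$, and let $G_{\mathbf i}(X)\in\mathbb R^{(d-1)\times(d-1)}$ have entries $\|x_{i_a}\|_2$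 on the diagonal and $x_{i_a}\cdot x_{i_b}/\|X\|_F$ for $a\neq b$. For $c>0$ let $$\Omega_c=\Big\{X\in\mathbb R^{d\times n}:\ X\text{ is centralized and }\max_{\mathbf i\in T(n,d-1)}\|x_{\mathbf i}^\perp\|_2\ge c\,\|X\|_F^{d-1}\Big\}.$$ For multisets $S=\{\!\{s_1,\dots,s_N\}\!\}$, $S'=\{\!\{s'_1,\dots,s'_N\}\!\}$ of $N$ vectors in the same space put $\mathcal W_\infty(S,S')=\min_{\tau\in S_N}\max_j\|s_j-s'_{\tau(j)}\|_\infty$. Let $\psi$ map pairs $(v,S)$, with $v\in\mathbb R^{(d-1)\times(d-1)}$ and $S$ a multiset of $n-d+1$ vectors in $\mathbb R^{d+1}$, to $\mathbb R^r$, and let $\phi$ map multisets of $|T(n,d-1)|$ vectors in $\mathbb R^r$ to $\mathbb R^m$. Assume that both are homogeneous, i.e. $\psi(tv,tS)=t\psi(v,S)$ and $\phi(tS)=t\phi(S)$ for all $t>0$, and bi-Lipschitz, i.e. there are constants $0<c_\psi\le C_\psi$ and $0<c_\phi\le C_\phi$ such that, for all arguments, $$c_\psi\max\{\|v-v'\|_\infty,\mathcal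 W_\infty(S,S')\}\le\|\psi(v,S)-\psi(v',S')\|_\infty\le C_\psi\max\{\|v-v'\|_\infty,\mathcal W_\infty(S,S')\},$$ $$c_\phi\,\mathcal W_\infty(S,S')\le\|\phi(S)-\phi(S')\|_\infty\le C_\phi\,\mathcal W_\infty(S,S'),$$ where $\|\cdot\|_\infty$ is the maximum absolute value of the entries. Define the model $H:\mathbb R^{d\times n}\to\mathbb R^m$ by first centralizing $X$ and then, writing $X$ also for the centralized point set, setting $H(X)=0$ if $X=0$ and otherwise $$h_{\mathbf i}(X)=\psi\Big(G_{\mathbf i}(X),\Big\{\!\!\Big\{\Big(\tfrac{x_{i_1}\cdot x_k}{\|X\|_F},\dots,\tfrac{x_{i_{d-1}}\cdot x_k}{\|X\|_F},\tfrac{x_{\mathbf i}^\perp\cdot x_k}{\|X\|_F^{d-1}},\|x_k\|_2\Big): k\in[n]\setminus\{i_1,\dots,i_{d-1}\}\Big\}\!\!\Big\}\Big),$$ $$H(X)=\phi\big(\{\!\{h_{\mathbf i}(X):\mathbf i\in T(n,d-1)\}\!\}\big).$$ Theorem. For every $c>0$, $H$ is bi-Lipschitz with respect to $d_{\mathcal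 G_+}$ on the point sets whose centralization lies in $\Omega_c$ (in particular, its restriction to $\Omega_c$ is bi-Lipschitz): there are constants $c',C'>0$ such that for all $X,Y\in\mathbb R^{d\times n}$ whose centralizations lie in $\Omega_c$, $$c'\,d_{\mathcal G_+}(X,Y)\le\|H(X)-H(Y)\|_2\le C'\,d_{\mathcal G_+}(X,Y).$$ -/

import Mathlib

noncomputable section

namespace PointSet

/-- A point set `X = (x_1, …, x_n)` of `n` points in `ℝ^d` (the columns of a `d × n` matrix). -/
abbrev PointCloud (d n : ℕ) : Type := Fin n → EuclideanSpace ℝ (Fin d)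

/-- The Frobenius norm of the `d × n` matrix with columns `x_1, …, x_n`. -/
def frobNorm {d n : ℕ} (X : PointCloud d n) : ℝ := Real.sqrt (∑ j, ‖X j‖ ^ 2)

/-- The mean of the points. -/
def mean {d n : ℕ} (X : PointCloud d n) : EuclideanSpace ℝ (Fin d) :=
  (n : ℝ)⁻¹ • ∑ j, X j

/-- Centralization: translate all the points by the mean, so that the new mean is `0`. -/
def centralize {d n : ℕ} (X : PointCloud d n) : PointCloud d n := fun j => X j - mean X

/-- The group `SO(d) ⋉ ℝ^d × S_n` of permutations and proper rigid motions, as the set of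
triples `(π, R, t)`. -/
abbrev GPlus (d n : ℕ) : Type :=
  Equiv.Perm (Fin n) × Matrix.specialOrthogonalGroup (Fin d) ℝ × EuclideanSpace ℝ (Fin d)

/-- The action on point sets: `(gY)_j = R y_{π(j)} + t`. -/
def GPlus.act {d n : ℕ} (g : GPlus d n) (Y : PointCloud d n) : PointCloud d n :=
  fun j => Matrix.toEuclideanLin (g.2.1 : Matrix (Fin d) (Fin d) ℝ) (Y (g.1 j)) + g.2.2

/-- The Procrustes matching metric `d_{G+}(X, Y) = min_g ‖X - gY‖_F`. -/
def dGPlus {d n : ℕ} (X Y : PointCloud d n) : ℝ :=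
  ⨅ g : GPlus d n, frobNorm (fun j => X j - g.act Y j)

/-- The matrix with columns `v_1, …, v_p, y` in `ℝ^(p+1)`. -/
def colMatrix {p : ℕ} (v : Fin p → EuclideanSpace ℝ (Fin (p + 1)))
    (y : EuclideanSpace ℝ (Fin (p + 1))) : Matrix (Fin (p + 1)) (Fin (p + 1)) ℝ :=
  Matrix.of fun a b =>
    (Fin.snoc (α := fun _ => EuclideanSpace ℝ (Fin (p + 1))) v y : _ → _) b a

/-- The generalized cross product (Hodge dual of the wedge product) of `p = d - 1` vectors in
`ℝ^d`; its coordinates are `det (v_1 ⋯ v_p e_a)`. See `inner_cross` for its characterization. -/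
def cross {p : ℕ} (v : Fin p → EuclideanSpace ℝ (Fin (p + 1))) :
    EuclideanSpace ℝ (Fin (p + 1)) :=
  WithLp.toLp 2 fun a => (colMatrix v (EuclideanSpace.single a 1)).det

/-- `cross v` is the (unique) vector `z` with `⟨z, y⟩ = det (v_1 ⋯ v_p y)` for all `y`. -/
theorem inner_cross {p : ℕ} (v : Fin p → EuclideanSpace ℝ (Fin (p + 1)))
    (y : EuclideanSpace ℝ (Fin (p + 1))) :
    inner ℝ (cross v) y = (colMatrix v y).det := by
  have key : ∀ w : EuclideanSpace ℝ (Fin (p + 1)), (colMatrix v w).det =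
      ∑ a, w a * ((-1) ^ ((a : ℕ) + p) *
        ((colMatrix v 0).submatrix a.succAbove (Fin.last p).succAbove).det) := by
    intro w
    rw [Matrix.det_succ_column _ (Fin.last p)]
    refine Finset.sum_congr rfl fun a _ => ?_
    have h1 : colMatrix v w a (Fin.last p) = w a := by simp [colMatrix]
    have h2 : (colMatrix v w).submatrix a.succAbove (Fin.last p).succAbove =
        (colMatrix v 0).submatrix a.succAbove (Fin.last p).succAbove := by
      ext i j
      simp [colMatrix]
    rw [h1, h2, Fin.val_last]
    ring
  rw [PiLp.inner_apply, key y]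
  refine Finset.sum_congr rfl fun a _ => ?_
  have : (cross v) a = (-1) ^ ((a : ℕ) + p) *
      ((colMatrix v 0).submatrix a.succAbove (Fin.last p).succAbove).det := by
    change (colMatrix v (EuclideanSpace.single a 1)).det = _
    rw [key, Finset.sum_eq_single a]
    · simp
    · intro b _ hb
      simp [hb]
    · simp
  rw [this]
  simp

/-- The index set `T(n, p)`: all `p`-tuples of distinct indices in `[n]`. -/
abbrev Tuples (n p : ℕ) : Type := Fin p ↪ Fin n

/-- The vector `x_𝐢^⊥` attached to the tuple `𝐢`. -/
def perp {p n : ℕ} (X : PointCloud (p + 1) n) (i : Tuples n p) :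
    EuclideanSpace ℝ (Fin (p + 1)) :=
  cross fun a => X (i a)

/-- `Ω_c`: centralized point sets in `ℝ^d`, `d = p + 1`, with
`max_𝐢 ‖x_𝐢^⊥‖ ≥ c ‖X‖_F^(d-1)`. -/
def Omega {p n : ℕ} (c : ℝ) : Set (PointCloud (p + 1) n) :=
  {X | mean X = 0 ∧ c * frobNorm X ^ p ≤ ⨆ i : Tuples n p, ‖perp X i‖}

/-- The normalized Gram matrix `G_𝐢(X)`. -/
def gram {p n : ℕ} (X : PointCloud (p + 1) n) (i : Tuples n p) : Fin p → Fin p → ℝ :=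
  fun a b => if a = b then ‖X (i a)‖ else inner ℝ (X (i a)) (X (i b)) / frobNorm X

/-- The feature vector `(x_{i_1}·x_k/‖X‖_F, …, x_{i_p}·x_k/‖X‖_F, x_𝐢^⊥·x_k/‖X‖_F^p, ‖x_k‖)`. -/
def feature {p n : ℕ} (X : PointCloud (p + 1) n) (i : Tuples n p) (k : Fin n) :
    Fin (p + 2) → ℝ :=
  Fin.snoc (α := fun _ => ℝ)
    (Fin.snoc (α := fun _ => ℝ) (fun a : Fin p => inner ℝ (X (i a)) (X k) / frobNorm X)
      (inner ℝ (perp X i) (X k) / frobNorm X ^ p))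
    ‖X k‖

/-- The multiset of the features of the points `x_k`, `k ∈ [n] ∖ {i_1, …, i_p}`. -/
def featureMultiset {p n : ℕ} (X : PointCloud (p + 1) n) (i : Tuples n p) :
    Multiset (Fin (p + 2) → ℝ) :=
  ((Finset.univ.map i)ᶜ : Finset (Fin n)).val.map (feature X i)

/-- The model `H`: centralize `X`, compute `h_𝐢 = ψ(G_𝐢, {{features}})` for all tuples `𝐢`, and
apply `φ` to the multiset of all the `h_𝐢`; the value is `0` if the centralized point set is `0`.
The output is viewed in `ℝ^m` with its Euclidean norm. -/
def model {p n r m : ℕ} (ψ : (Fin p → Fin p → ℝ) → Multiset (Fin (p + 2) → ℝ) → (Fin r → ℝ))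
    (φ : Multiset (Fin r → ℝ) → (Fin m → ℝ)) (X : PointCloud (p + 1) n) :
    EuclideanSpace ℝ (Fin m) :=
  open Classical in
  if centralize X = 0 then 0
  else WithLp.toLp 2 (φ ((Finset.univ : Finset (Tuples n p)).val.map fun i =>
    ψ (gram (centralize X) i) (featureMultiset (centralize X) i)))

/-- The multiset `{{x_1, …, x_N}}`. -/
def multisetOf {N : ℕ} {E : Type*} (x : Fin N → E) : Multiset E := Finset.univ.val.map x

/-- The `∞`-Wasserstein distance between the multisets `{{x_i}}` and `{{y_i}}` of `N` vectors of
`ℝ^q`: `min_τ max_i ‖x_i - y_{τ(i)}‖_∞`. (All norms on function types are sup norms.) -/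
def wassersteinInf {N q : ℕ} (x y : Fin N → (Fin q → ℝ)) : ℝ :=
  ⨅ τ : Equiv.Perm (Fin N), ‖fun i => x i - y (τ i)‖

/-- `φ(tS) = t φ(S)` for all `t > 0` and all multisets `S` of `N` vectors. -/
def HomogeneousReadout {q m : ℕ} (N : ℕ) (φ : Multiset (Fin q → ℝ) → (Fin m → ℝ)) : Prop :=
  ∀ t : ℝ, 0 < t → ∀ x : Fin N → (Fin q → ℝ),
    φ (multisetOf (t • x)) = t • φ (multisetOf x)

/-- `φ` is bi-Lipschitz on multisets of `N` vectors, for the `∞`-Wasserstein distance. -/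
def BiLipschitzReadout {q m : ℕ} (N : ℕ) (φ : Multiset (Fin q → ℝ) → (Fin m → ℝ)) : Prop :=
  ∃ c C : ℝ, 0 < c ∧ c ≤ C ∧ ∀ x y : Fin N → (Fin q → ℝ),
    c * wassersteinInf x y ≤ ‖φ (multisetOf x) - φ (multisetOf y)‖ ∧
    ‖φ (multisetOf x) - φ (multisetOf y)‖ ≤ C * wassersteinInf x y

/-- `ψ(tv, tS) = t ψ(v, S)` for all `t > 0`, all `v` and all multisets `S` of `N` vectors. -/
def HomogeneousUpdate {p q r : ℕ} (N : ℕ)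
    (ψ : (Fin p → Fin p → ℝ) → Multiset (Fin q → ℝ) → (Fin r → ℝ)) : Prop :=
  ∀ t : ℝ, 0 < t → ∀ (v : Fin p → Fin p → ℝ) (x : Fin N → (Fin q → ℝ)),
    ψ (t • v) (multisetOf (t • x)) = t • ψ v (multisetOf x)

/-- `ψ` is bi-Lipschitz for the distance `max {‖v - v'‖_∞, W_∞(S, S')}` on pairs `(v, S)`, where
`S` is a multiset of `N` vectors. -/
def BiLipschitzUpdate {p q r : ℕ} (N : ℕ)
    (ψ : (Fin p → Fin p → ℝ) → Multiset (Fin q → ℝ) → (Fin r → ℝ)) : Prop :=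
  ∃ c C : ℝ, 0 < c ∧ c ≤ C ∧
    ∀ (v w : Fin p → Fin p → ℝ) (x y : Fin N → (Fin q → ℝ)),
      c * max ‖v - w‖ (wassersteinInf x y) ≤ ‖ψ v (multisetOf x) - ψ w (multisetOf y)‖ ∧
      ‖ψ v (multisetOf x) - ψ w (multisetOf y)‖ ≤ C * max ‖v - w‖ (wassersteinInf x y)

/-- `f` is bi-Lipschitz (upper and lower Lipschitz) on `S` with respect to `dist`. -/
def BiLipschitzOnWrt {V : Type*} {m : ℕ} (f : V → EuclideanSpace ℝ (Fin m))
    (dist : V → V → ℝ) (S : Set V) : Prop :=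
  (∃ C : ℝ, 0 < C ∧ ∀ X ∈ S, ∀ Y ∈ S, ‖f X - f Y‖ ≤ C * dist X Y) ∧
  (∃ c : ℝ, 0 < c ∧ ∀ X ∈ S, ∀ Y ∈ S, c * dist X Y ≤ ‖f X - f Y‖)

end PointSet

end

/-!
The features of `X` at a tuple `𝐢` are the inner products of the points with the frame
`x_{i_1}, …, x_{i_p}, x_𝐢^⊥`, rescaled to be homogeneous of degree one, together with the norms of
the points. Since `ψ` and `φ` are bi-Lipschitz, the model may be replaced by the multiset, over all
tuples `𝐢`, of these features.

*Upper bound.* Each feature is a norm or has the form `‖X‖ P(X / ‖X‖)` with `P` a polynomial, hence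
is Lipschitz on all point sets (`exists_lipschitz_homogeneous_extension`,
`exists_lipschitz_gram_feature`). The multiset of features is invariant under rotations and
permutations (`multisetOf_tupleFamily_rotPerm`), and centralization removes the translation at the
cost of a constant factor. By homogeneity of `ψ` and `φ` the point set `0` needs no separate
treatment (`model_eq`).

*Lower bound.* Take a tuple `𝐢` with maximal `‖x_𝐢^⊥‖`, the tuple `𝐣` of `Y` matched with it, and
the permutation of the points that matches the features at `𝐢` and `𝐣`. The norms of the points
determine the scales `‖X‖` and `‖Y‖` up to the error, so after rescaling to unit Frobenius norm one
has two frames with close inner products, the first one uniformly nondegenerate. If `A` and `B`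
are the matrices of these frames, completed by their cross products, then `Aᵀ A` is close to `Bᵀ B`;
the last diagonal entries are the Gram determinants (`norm_cross_sq`). The orthogonal factor of the
polar decomposition of `B A⁻¹` has determinant `1`, because `det A = ‖x_𝐢^⊥‖² > 0` and
`det B = ‖y_𝐣^⊥‖² ≥ 0`, and it moves one frame to the other up to a linear error
(`exists_specialOrthogonal_of_gram_close`). A point is a Lipschitz function of its inner products
with a nondegenerate frame, so the same rotation aligns all the points
(`exists_rotation_of_inner_close`). When the error is not small compared with the scale, the trivial
rotation is good enough.
-/

namespace PointSet

open scoped Matrix MatrixOrder Matrix.Norms.L2Operator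

/-! ### Operator norms and polar factors of real matrices -/

theorem exists_norm_le_of_entry_le (d : ℕ) :
    ∃ K : ℝ, 0 ≤ K ∧ ∀ (A : Matrix (Fin d) (Fin d) ℝ) (δ : ℝ), (∀ i j, |A i j| ≤ δ) →
      ‖A‖ ≤ K * δ := by
  refine ⟨∑ i, ∑ j, ‖Matrix.single (α := ℝ) (i : Fin d) (j : Fin d) 1‖, by positivity, ?_⟩
  intro A δ h
  rw [Finset.sum_mul]
  conv_lhs => rw [Matrix.matrix_eq_sum_single A]
  refine (norm_sum_le _ _).trans (Finset.sum_le_sum fun i _ => ?_)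
  rw [Finset.sum_mul]
  refine (norm_sum_le _ _).trans (Finset.sum_le_sum fun j _ => ?_)
  have : Matrix.single i j (A i j) = A i j • Matrix.single (α := ℝ) i j 1 := by simp
  rw [this, norm_smul, Real.norm_eq_abs, mul_comm]
  gcongr
  exact h i j

/-- Since `P² - 1 = (P + 1)(P - 1)` and `P + 1` does not shrink vectors, taking the square root
of a positive semidefinite matrix does not increase the distance to the identity. -/
theorem norm_sub_one_le_of_posSemidef {d : ℕ} {P : Matrix (Fin d) (Fin d) ℝ}
    (hP : P.PosSemidef) : ‖P - 1‖ ≤ ‖P * P - 1‖ := by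
  rw [Matrix.cstar_norm_def (P - 1)]
  refine ContinuousLinearMap.opNorm_le_bound _ (norm_nonneg _) fun x => ?_
  set T := Matrix.toEuclideanCLM (n := Fin d) (𝕜 := ℝ) P with hT
  have hpos : ∀ y, 0 ≤ inner ℝ (T y) y := by
    intro y
    have := hP.dotProduct_mulVec_nonneg y.ofLp
    rw [hT, real_inner_comm, Matrix.inner_toEuclideanCLM]
    simpa using this
  have hlow : ∀ y, ‖y‖ ≤ ‖T y + y‖ := by
    intro y
    have h1 : ‖T y + y‖ ^ 2 = ‖T y‖ ^ 2 + 2 * inner ℝ (T y) y + ‖y‖ ^ 2 := norm_add_sq_real _ _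
    have h2 := hpos y
    exact le_of_sq_le_sq (by nlinarith [sq_nonneg ‖T y‖]) (norm_nonneg _)
  have h3 : Matrix.toEuclideanCLM (n := Fin d) (𝕜 := ℝ) (P - 1) x = T x - x := by
    rw [map_sub, map_one]; rfl
  have h4 : Matrix.toEuclideanCLM (n := Fin d) (𝕜 := ℝ) (P * P - 1) x
      = T (T x - x) + (T x - x) := by
    rw [map_sub, map_one, map_mul, map_sub]
    change T (T x) - x = _
    abel
  rw [h3]
  refine (hlow _).trans ?_
  rw [← h4, Matrix.cstar_norm_def]
  exact ContinuousLinearMap.le_opNorm _ _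

/-- The polar decomposition `B A⁻¹ = R P` yields a rotation `R` carrying the frame `A` close to
the frame `B` as soon as the Gram matrices `Aᵀ A` and `Bᵀ B` are close. -/
theorem exists_specialOrthogonal_of_gram_close {d : ℕ} {A B : Matrix (Fin d) (Fin d) ℝ}
    (hA : 0 < A.det) (hB : 0 ≤ B.det)
    (h : ‖(A⁻¹)ᵀ * (Aᵀ * A - Bᵀ * B) * A⁻¹‖ < 1) :
    ∃ R ∈ Matrix.specialOrthogonalGroup (Fin d) ℝ, ∃ P : Matrix (Fin d) (Fin d) ℝ,
      Bᵀ = Aᵀ * P * Rᵀ ∧ ‖P - 1‖ ≤ ‖(A⁻¹)ᵀ * (Aᵀ * A - Bᵀ * B) * A⁻¹‖ := by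
  have hAu : IsUnit A.det := isUnit_iff_ne_zero.2 hA.ne'
  set D := (A⁻¹)ᵀ * (Aᵀ * A - Bᵀ * B) * A⁻¹ with hD
  set M := B * A⁻¹ with hM
  have hS : Mᵀ * M = 1 - D := by
    have e1 : (A⁻¹)ᵀ * Aᵀ = 1 := by
      rw [← Matrix.transpose_mul, Matrix.mul_nonsing_inv _ hAu, Matrix.transpose_one]
    have e2 : A * A⁻¹ = 1 := Matrix.mul_nonsing_inv _ hAu
    have : D = ((A⁻¹)ᵀ * Aᵀ) * (A * A⁻¹) - Mᵀ * M := by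
      rw [hD, hM, Matrix.transpose_mul]
      noncomm_ring
    rw [this, e1, e2]
    simp
  have hpsd : (Mᵀ * M).PosSemidef := by
    simpa using Matrix.posSemidef_conjTranspose_mul_self M
  set P := CFC.sqrt (Mᵀ * M) with hPdef
  have hPP : P * P = Mᵀ * M := by
    have := hpsd.nonneg
    exact CFC.sqrt_mul_sqrt_self _
  have hPpsd : P.PosSemidef := Matrix.nonneg_iff_posSemidef.1 (CFC.sqrt_nonneg (Mᵀ * M))
  have hSu : IsUnit (Mᵀ * M) := by
    rw [hS]; exact isUnit_one_sub_of_norm_lt_one h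
  have hPdet : P.det ≠ 0 := by
    intro h0
    have := (Matrix.isUnit_iff_isUnit_det _).1 hSu
    rw [← hPP, Matrix.det_mul, h0] at this
    simp at this
  have hPu : IsUnit P.det := isUnit_iff_ne_zero.2 hPdet
  have hPT : Pᵀ = P := by simpa using hPpsd.isHermitian.eq
  have hPiT : (P⁻¹)ᵀ = P⁻¹ := by rw [Matrix.transpose_nonsing_inv, hPT]
  set R := M * P⁻¹ with hR
  have hRR : Rᵀ * R = 1 := by
    have : Rᵀ * R = P⁻¹ * (P * P) * P⁻¹ := by
      rw [hPP, hR, Matrix.transpose_mul, hPiT]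
      noncomm_ring
    rw [this, ← Matrix.mul_assoc, Matrix.nonsing_inv_mul _ hPu, Matrix.one_mul,
      Matrix.mul_nonsing_inv _ hPu]
  have hRdet0 : 0 ≤ R.det := by
    rw [hR, hM, Matrix.det_mul, Matrix.det_mul, Matrix.det_nonsing_inv, Matrix.det_nonsing_inv]
    simp only [Ring.inverse_eq_inv']
    have := hPpsd.det_nonneg
    positivity
  have hRdet : R.det = 1 := by
    have := congrArg Matrix.det hRR
    rw [Matrix.det_mul, Matrix.det_transpose, Matrix.det_one] at this
    nlinarith
  refine ⟨R, ?_, P, ?_, ?_⟩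
  · rw [Matrix.mem_specialOrthogonalGroup_iff, Matrix.mem_orthogonalGroup_iff']
    exact ⟨by simpa [Matrix.star_eq_conjTranspose] using hRR, hRdet⟩
  · have h1 : B = R * P * A := by
      rw [hR, Matrix.mul_assoc M, Matrix.nonsing_inv_mul _ hPu, Matrix.mul_one, hM,
        Matrix.mul_assoc, Matrix.nonsing_inv_mul _ hAu, Matrix.mul_one]
    conv_lhs => rw [h1]
    rw [Matrix.transpose_mul, Matrix.transpose_mul, hPT, Matrix.mul_assoc]
  · refine (norm_sub_one_le_of_posSemidef hPpsd).trans ?_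
    rw [hPP, hS]
    simp

/-! ### The generalized cross product -/

theorem colMatrix_castSucc {p : ℕ} (v : Fin p → EuclideanSpace ℝ (Fin (p + 1)))
    (y : EuclideanSpace ℝ (Fin (p + 1))) (i : Fin (p + 1)) (j : Fin p) :
    colMatrix v y i j.castSucc = v j i := by simp [colMatrix]

theorem colMatrix_last {p : ℕ} (v : Fin p → EuclideanSpace ℝ (Fin (p + 1)))
    (y : EuclideanSpace ℝ (Fin (p + 1))) (i : Fin (p + 1)) :
    colMatrix v y i (Fin.last p) = y i := by simp [colMatrix]

theorem inner_cross_self_right {p : ℕ} (v : Fin p → EuclideanSpace ℝ (Fin (p + 1))) (a : Fin p) :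
    inner ℝ (cross v) (v a) = 0 := by
  rw [inner_cross]
  refine Matrix.det_zero_of_column_eq (Fin.castSucc_lt_last a).ne fun i => ?_
  rw [colMatrix_castSucc, colMatrix_last]

theorem inner_self_right_cross {p : ℕ} (v : Fin p → EuclideanSpace ℝ (Fin (p + 1))) (a : Fin p) :
    inner ℝ (v a) (cross v) = 0 := by
  rw [real_inner_comm, inner_cross_self_right]

theorem det_colMatrix_cross {p : ℕ} (v : Fin p → EuclideanSpace ℝ (Fin (p + 1))) :
    (colMatrix v (cross v)).det = ‖cross v‖ ^ 2 := by
  rw [← inner_cross, real_inner_self_eq_norm_sq]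

/-- The Gram matrix of a finite family of vectors. -/
noncomputable def gramMatrix {p d : ℕ} (v : Fin p → EuclideanSpace ℝ (Fin d)) :
    Matrix (Fin p) (Fin p) ℝ :=
  Matrix.of fun a b => inner ℝ (v a) (v b)

theorem colMatrix_transpose_mul_apply {p : ℕ} (v w : Fin p → EuclideanSpace ℝ (Fin (p + 1)))
    (y z : EuclideanSpace ℝ (Fin (p + 1))) (i j : Fin (p + 1)) :
    ((colMatrix v y)ᵀ * colMatrix w z) i j =
      inner ℝ ((Fin.snoc (α := fun _ => EuclideanSpace ℝ (Fin (p + 1))) v y : _ → _) i)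
        ((Fin.snoc (α := fun _ => EuclideanSpace ℝ (Fin (p + 1))) w z : _ → _) j) := by
  rw [Matrix.mul_apply, PiLp.inner_apply]
  refine Finset.sum_congr rfl fun a _ => ?_
  simp [colMatrix, mul_comm]

/-- For `y` orthogonal to all the `v_a`, the Gram matrix of `v_1, …, v_p, y` is block diagonal. -/
theorem det_colMatrix_sq_of_orthogonal {p : ℕ} (v : Fin p → EuclideanSpace ℝ (Fin (p + 1)))
    (y : EuclideanSpace ℝ (Fin (p + 1))) (h : ∀ a, inner ℝ (v a) y = 0) :
    (colMatrix v y).det ^ 2 = (gramMatrix v).det * ‖y‖ ^ 2 := by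
  have h1 : (colMatrix v y).det ^ 2 = ((colMatrix v y)ᵀ * colMatrix v y).det := by
    rw [Matrix.det_mul, Matrix.det_transpose, sq]
  rw [h1, Matrix.det_succ_column _ (Fin.last p), Finset.sum_eq_single (Fin.last p)]
  · rw [colMatrix_transpose_mul_apply]
    have h2 : ((colMatrix v y)ᵀ * colMatrix v y).submatrix (Fin.last p).succAbove
        (Fin.last p).succAbove = gramMatrix v := by
      ext a b
      rw [Matrix.submatrix_apply, colMatrix_transpose_mul_apply]
      simp [gramMatrix]
    rw [h2, Fin.snoc_last, real_inner_self_eq_norm_sq, ← two_mul, pow_mul]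
    ring
  · intro i _ hi
    obtain ⟨a, rfl⟩ := Fin.exists_castSucc_eq.2 hi
    rw [colMatrix_transpose_mul_apply]
    simp [h a]
  · simp

/-- The norm of the cross product is the volume of the parallelepiped spanned by the vectors. -/
theorem norm_cross_sq {p : ℕ} (v : Fin p → EuclideanSpace ℝ (Fin (p + 1))) :
    ‖cross v‖ ^ 2 = (gramMatrix v).det := by
  -- The identity for the determinant of `v_1, …, v_p, y` with `y` orthogonal to the `v_a` is applied
  -- to `y = cross v`, or to any nonzero such `y` when the cross product vanishes.
  by_cases h : cross v = 0
  · obtain ⟨y, hy, hy0⟩ : ∃ y ∈ (Submodule.span ℝ (Set.range v))ᗮ, y ≠ 0 := by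
      apply Submodule.exists_mem_ne_zero_of_ne_bot
      intro hbot
      have h1 := Submodule.finrank_add_finrank_orthogonal (Submodule.span ℝ (Set.range v))
      have h2 := finrank_range_le_card (R := ℝ) v
      rw [hbot, finrank_bot, finrank_euclideanSpace_fin] at h1
      rw [Set.finrank, Fintype.card_fin] at h2
      omega
    have h3 := det_colMatrix_sq_of_orthogonal v y fun a =>
      (Submodule.mem_orthogonal _ _).1 hy _ (Submodule.subset_span ⟨a, rfl⟩)
    rw [← inner_cross, h, inner_zero_left] at h3
    have : ‖y‖ ^ 2 ≠ 0 := by simpa using hy0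
    rw [h, norm_zero]
    have h4 : (gramMatrix v).det = 0 := by
      rcases mul_eq_zero.1 (by simpa using h3.symm : (gramMatrix v).det * ‖y‖ ^ 2 = 0) with h | h
      · exact h
      · exact absurd h this
    rw [h4]; simp
  · have h3 := det_colMatrix_sq_of_orthogonal v (cross v) (inner_self_right_cross v)
    rw [det_colMatrix_cross, sq (‖cross v‖ ^ 2)] at h3
    exact mul_right_cancel₀ (by simpa using h) h3

theorem contDiff_det {d : ℕ} {E : Type*} [NormedAddCommGroup E] [NormedSpace ℝ E]
    {f : E → Matrix (Fin d) (Fin d) ℝ} (h : ∀ i j, ContDiff ℝ 1 fun x => f x i j) :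
    ContDiff ℝ 1 fun x => (f x).det := by
  simp only [Matrix.det_apply]
  exact ContDiff.sum fun σ _ => (contDiff_prod fun i _ => h _ _).const_smul _

/-! ### Stability of the alignment of two frames -/

theorem norm_piLp_le_sum {ι E : Type*} [Fintype ι] [NormedAddCommGroup E]
    (x : PiLp 2 fun _ : ι => E) : ‖x‖ ≤ ∑ i, ‖x i‖ := by
  refine le_of_sq_le_sq ?_ (Finset.sum_nonneg fun i _ => norm_nonneg _)
  rw [PiLp.norm_sq_eq_of_L2]
  exact Finset.sum_sq_le_sq_sum_of_nonneg fun i _ => norm_nonneg _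

theorem contDiff_colMatrix_apply {p : ℕ} {E : Type*} [NormedAddCommGroup E] [NormedSpace ℝ E]
    {f : E → Fin p → EuclideanSpace ℝ (Fin (p + 1))} {g : E → EuclideanSpace ℝ (Fin (p + 1))}
    (hf : ∀ a, ContDiff ℝ 1 fun x => f x a) (hg : ContDiff ℝ 1 g) (i j : Fin (p + 1)) :
    ContDiff ℝ 1 fun x => colMatrix (f x) (g x) i j := by
  induction j using Fin.lastCases with
  | last => simp only [colMatrix_last]; fun_prop
  | cast a => simp only [colMatrix_castSucc]; have := hf a; fun_prop

theorem contDiff_cross {p : ℕ} {E : Type*} [NormedAddCommGroup E] [NormedSpace ℝ E]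
    {f : E → Fin p → EuclideanSpace ℝ (Fin (p + 1))}
    (hf : ∀ a, ContDiff ℝ 1 fun x => f x a) : ContDiff ℝ 1 fun x => cross (f x) := by
  rw [contDiff_euclidean]
  intro i
  exact contDiff_det (contDiff_colMatrix_apply hf contDiff_const)

theorem exists_norm_cross_le (p : ℕ) : ∃ K : ℝ, 0 ≤ K ∧
    ∀ a : Fin p → EuclideanSpace ℝ (Fin (p + 1)), (∀ i, ‖a i‖ ≤ 1) → ‖cross a‖ ≤ K := by
  have hc : Continuous fun a : Fin p → EuclideanSpace ℝ (Fin (p + 1)) => cross a :=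
    (contDiff_cross fun i => contDiff_apply _ _ i).continuous
  obtain ⟨K, hK⟩ := (isCompact_closedBall
    (0 : Fin p → EuclideanSpace ℝ (Fin (p + 1))) 1).exists_bound_of_continuousOn hc.continuousOn
  refine ⟨max K 0, le_max_right _ _, fun a ha => (hK a ?_).trans (le_max_left _ _)⟩
  rw [mem_closedBall_zero_iff, pi_norm_le_iff_of_nonneg zero_le_one]
  exact ha

/-- Frames `(a, a^⊥)` whose cross product is bounded away from `0` are uniformly invertible. -/
theorem exists_norm_inv_colMatrix_le (p : ℕ) {c : ℝ} (hc : 0 < c) : ∃ K : ℝ, 0 ≤ K ∧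
    ∀ a : Fin p → EuclideanSpace ℝ (Fin (p + 1)), (∀ i, ‖a i‖ ≤ 1) → c ≤ ‖cross a‖ →
      ‖(colMatrix a (cross a))⁻¹‖ ≤ K := by
  have hcont : Continuous fun a : Fin p → EuclideanSpace ℝ (Fin (p + 1)) =>
      (colMatrix a (cross a)).adjugate := by
    refine Continuous.matrix_adjugate (continuous_matrix fun i j => ?_)
    exact (contDiff_colMatrix_apply (fun a => contDiff_apply _ _ a)
      (contDiff_cross fun i => contDiff_apply _ _ i) i j).continuous
  obtain ⟨K, hK⟩ := (isCompact_closedBall (0 : Fin p → EuclideanSpace ℝ (Fin (p + 1)))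
    1).exists_bound_of_continuousOn hcont.continuousOn
  refine ⟨(c ^ 2)⁻¹ * max K 0, by positivity, fun a ha hca => ?_⟩
  have h1 : ‖(colMatrix a (cross a)).adjugate‖ ≤ max K 0 := by
    refine (hK a ?_).trans (le_max_left _ _)
    rw [mem_closedBall_zero_iff, pi_norm_le_iff_of_nonneg zero_le_one]
    exact ha
  rw [Matrix.inv_def, det_colMatrix_cross, Ring.inverse_eq_inv', norm_smul, norm_inv, norm_pow,
    norm_norm]
  gcongr

theorem exists_abs_det_sub_le (p : ℕ) : ∃ L : ℝ, 0 ≤ L ∧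
    ∀ (G G' : Matrix (Fin p) (Fin p) ℝ) (δ : ℝ), 0 ≤ δ → (∀ i j, |G i j| ≤ 1) →
      (∀ i j, |G' i j| ≤ 1) → (∀ i j, |G i j - G' i j| ≤ δ) → |G.det - G'.det| ≤ L * δ := by
  have hd : ContDiff ℝ 1 fun G : Fin p → Fin p → ℝ => (Matrix.of G).det :=
    contDiff_det fun i j => by simp only [Matrix.of_apply]; fun_prop
  obtain ⟨L, hL⟩ := hd.contDiffOn.exists_lipschitzOnWith one_ne_zero
    (convex_closedBall (0 : Fin p → Fin p → ℝ) 1) (isCompact_closedBall _ _)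
  refine ⟨L, L.2, fun G G' δ hδ hG hG' h => ?_⟩
  have key : ∀ (F : Fin p → Fin p → ℝ) (r : ℝ), 0 ≤ r → (∀ i j, |F i j| ≤ r) → ‖F‖ ≤ r := by
    intro F r hr hF
    rw [pi_norm_le_iff_of_nonneg hr]
    intro i
    rw [pi_norm_le_iff_of_nonneg hr]
    exact hF i
  have h1 := hL.norm_sub_le (mem_closedBall_zero_iff.2 (key (fun i j => G i j) 1 zero_le_one hG))
    (mem_closedBall_zero_iff.2 (key (fun i j => G' i j) 1 zero_le_one hG'))
  refine h1.trans ?_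
  gcongr
  exact key _ _ hδ h

theorem abs_inner_le_one {d : ℕ} {x y : EuclideanSpace ℝ (Fin d)} (hx : ‖x‖ ≤ 1) (hy : ‖y‖ ≤ 1) :
    |inner ℝ x y| ≤ 1 :=
  (abs_real_inner_le_norm x y).trans (mul_le_one₀ hx (norm_nonneg _) hy)

theorem toEuclideanCLM_transpose_colMatrix_apply {p : ℕ}
    (v : Fin p → EuclideanSpace ℝ (Fin (p + 1))) (y u : EuclideanSpace ℝ (Fin (p + 1)))
    (i : Fin (p + 1)) :
    Matrix.toEuclideanCLM (n := Fin (p + 1)) (𝕜 := ℝ) (colMatrix v y)ᵀ u i =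
      inner ℝ ((Fin.snoc (α := fun _ => EuclideanSpace ℝ (Fin (p + 1))) v y : _ → _) i) u := by
  rw [Matrix.ofLp_toEuclideanCLM, Matrix.mulVec, dotProduct, PiLp.inner_apply]
  refine Finset.sum_congr rfl fun a _ => ?_
  simp [colMatrix, mul_comm]

/-- Linear stability of rigid alignment: if the inner products within two frames, and those of
`u`, `v` with the frames, agree up to `δ`, then one rotation, independent of `u` and `v`, carries
every such `v` to within `O(δ)` of `u`. For small `δ` the nondegeneracy of the frame `b` follows from
that of `a`. -/
theorem exists_rotation_of_inner_close (p : ℕ) {c : ℝ} (hc : 0 < c) : ∃ C : ℝ, 0 ≤ C ∧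
    ∀ (a b : Fin p → EuclideanSpace ℝ (Fin (p + 1))) (δ : ℝ), 0 ≤ δ →
      (∀ i, ‖a i‖ ≤ 1) → (∀ i, ‖b i‖ ≤ 1) → c ≤ ‖cross a‖ →
      (∀ i j, |inner ℝ (a i) (a j) - inner ℝ (b i) (b j)| ≤ δ) →
      ∃ R ∈ Matrix.specialOrthogonalGroup (Fin (p + 1)) ℝ,
        ∀ u v : EuclideanSpace ℝ (Fin (p + 1)), ‖u‖ ≤ 1 → ‖v‖ ≤ 1 →
          (∀ i, |inner ℝ (a i) u - inner ℝ (b i) v| ≤ δ) →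
          |inner ℝ (cross a) u - inner ℝ (cross b) v| ≤ δ →
          ‖u - Matrix.toEuclideanLin R v‖ ≤ C * δ := by
  obtain ⟨K, hK0, hK⟩ := exists_norm_inv_colMatrix_le p hc
  obtain ⟨L, hL0, hL⟩ := exists_abs_det_sub_le p
  obtain ⟨K₁, hK₁0, hK₁⟩ := exists_norm_le_of_entry_le (p + 1)
  -- `Q δ` bounds the distance to `1` of the Gram matrix of `B A⁻¹`.
  set Q := K * (K₁ * (1 + L)) * K with hQ
  have hQ0 : 0 ≤ Q := by positivity
  refine ⟨K * (p + 1) + 2 * Q, by positivity, ?_⟩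
  intro a b δ hδ ha hb hca hab
  set A := colMatrix a (cross a) with hA
  set B := colMatrix b (cross b) with hB
  have hAdet : 0 < A.det := by
    rw [hA, det_colMatrix_cross]
    have := hc.trans_le hca
    positivity
  have hBdet : 0 ≤ B.det := by
    rw [hB, det_colMatrix_cross]
    positivity
  have hAi : ‖A⁻¹‖ ≤ K := hK a ha hca
  have hAiT : ‖(A⁻¹)ᵀ‖ ≤ K := by
    have := Matrix.l2_opNorm_conjTranspose A⁻¹
    rw [Matrix.conjTranspose_eq_transpose_of_trivial] at this
    rwa [this]
  have hcross : |‖cross a‖ ^ 2 - ‖cross b‖ ^ 2| ≤ L * δ := by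
    rw [norm_cross_sq, norm_cross_sq]
    exact hL _ _ δ hδ (fun i j => abs_inner_le_one (ha i) (ha j))
      (fun i j => abs_inner_le_one (hb i) (hb j)) hab
  have hent : ∀ i j, |(Aᵀ * A - Bᵀ * B) i j| ≤ (1 + L) * δ := by
    intro i j
    have hLδ : 0 ≤ L * δ := by positivity
    rw [Matrix.sub_apply, colMatrix_transpose_mul_apply, colMatrix_transpose_mul_apply]
    induction i using Fin.lastCases with
    | last =>
      induction j using Fin.lastCases with
      | last =>
        simp only [Fin.snoc_last, real_inner_self_eq_norm_sq]
        linarith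
      | cast j =>
        simp only [Fin.snoc_last, Fin.snoc_castSucc, inner_cross_self_right, sub_zero, abs_zero]
        positivity
    | cast i =>
      induction j using Fin.lastCases with
      | last =>
        simp only [Fin.snoc_last, Fin.snoc_castSucc, inner_self_right_cross, sub_zero, abs_zero]
        positivity
      | cast j =>
        simp only [Fin.snoc_castSucc]
        linarith [hab i j]
  have hD : ‖(A⁻¹)ᵀ * (Aᵀ * A - Bᵀ * B) * A⁻¹‖ ≤ Q * δ := by
    calc _ ≤ ‖(A⁻¹)ᵀ‖ * ‖Aᵀ * A - Bᵀ * B‖ * ‖A⁻¹‖ :=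
          (norm_mul_le _ _).trans (by gcongr; exact norm_mul_le _ _)
      _ ≤ K * (K₁ * ((1 + L) * δ)) * K := by
          gcongr
          exact hK₁ _ _ hent
      _ = Q * δ := by rw [hQ]; ring
  rcases lt_or_ge (Q * δ) 1 with hsmall | hlarge
  · obtain ⟨R, hR, P, hBP, hP⟩ :=
      exists_specialOrthogonal_of_gram_close hAdet hBdet (hD.trans_lt hsmall)
    have hRT : Rᵀ ∈ Matrix.specialOrthogonalGroup (Fin (p + 1)) ℝ :=
      (⟨R, hR⟩⁻¹ : Matrix.specialOrthogonalGroup (Fin (p + 1)) ℝ).2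
    refine ⟨Rᵀ, hRT, fun u v hu hv h1 h2 => ?_⟩
    set T := Matrix.toEuclideanCLM (n := Fin (p + 1)) (𝕜 := ℝ) with hT
    have hTR : Matrix.toEuclideanLin Rᵀ v = T Rᵀ v := rfl
    have hRn : ‖Rᵀ‖ ≤ 1 := by
      have := (Matrix.mem_orthogonalGroup_iff' _ _).1 (Matrix.mem_specialOrthogonalGroup_iff.1 hRT).1
      have h3 := CStarRing.norm_star_mul_self (x := Rᵀ)
      rw [Matrix.star_eq_conjTranspose, Matrix.conjTranspose_eq_transpose_of_trivial, this] at h3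
      have h4 : ‖(1 : Matrix (Fin (p + 1)) (Fin (p + 1)) ℝ)‖ ≤ 1 := by
        simp
      nlinarith [norm_nonneg Rᵀ]
    have hnorm : ∀ (M : Matrix (Fin (p + 1)) (Fin (p + 1)) ℝ) w, ‖T M w‖ ≤ ‖M‖ * ‖w‖ := by
      intro M w
      rw [Matrix.cstar_norm_def]
      exact ContinuousLinearMap.le_opNorm _ _
    have hmul : ∀ (M N : Matrix (Fin (p + 1)) (Fin (p + 1)) ℝ) w, T (M * N) w = T M (T N w) := by
      intro M N w
      rw [map_mul]; rfl
    have hinv : (A⁻¹)ᵀ * Aᵀ = 1 := by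
      rw [← Matrix.transpose_mul, Matrix.mul_nonsing_inv _ (isUnit_iff_ne_zero.2 hAdet.ne'),
        Matrix.transpose_one]
    -- `Aᵀ u` and `Bᵀ v` collect the inner products with the frames, and `Bᵀ = Aᵀ P Rᵀ`.
    have hdecomp : u - T Rᵀ v = T (A⁻¹)ᵀ (T Aᵀ u - T Bᵀ v) + T (P - 1) (T Rᵀ v) := by
      have e1 : ∀ w, T (A⁻¹)ᵀ (T Aᵀ w) = w := by
        intro w
        rw [← hmul, hinv, map_one]; rfl
      rw [map_sub, e1, hBP, Matrix.mul_assoc, hmul Aᵀ, e1, hmul P, map_sub, map_one]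
      change _ = u - T P (T Rᵀ v) + (T P (T Rᵀ v) - T Rᵀ v)
      abel
    have hvec : ‖T Aᵀ u - T Bᵀ v‖ ≤ (p + 1) * δ := by
      refine (norm_piLp_le_sum _).trans ?_
      have : ∀ i ∈ Finset.univ, ‖(T Aᵀ u - T Bᵀ v) i‖ ≤ δ := by
        intro i _
        rw [PiLp.sub_apply, hT, toEuclideanCLM_transpose_colMatrix_apply,
          toEuclideanCLM_transpose_colMatrix_apply, Real.norm_eq_abs]
        induction i using Fin.lastCases with
        | last => simpa only [Fin.snoc_last] using h2
        | cast i => simpa only [Fin.snoc_castSucc] using h1 i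
      refine (Finset.sum_le_card_nsmul _ _ _ this).trans ?_
      simp
    rw [hTR, hdecomp]
    calc _ ≤ ‖(A⁻¹)ᵀ‖ * ‖T Aᵀ u - T Bᵀ v‖ + ‖P - 1‖ * (‖Rᵀ‖ * ‖v‖) := by
          refine (norm_add_le _ _).trans (add_le_add (hnorm _ _) ((hnorm _ _).trans ?_))
          gcongr
          exact hnorm _ _
      _ ≤ K * ((p + 1) * δ) + Q * δ * (1 * 1) := by
          gcongr
          exact hP.trans hD
      _ ≤ _ := by nlinarith [mul_nonneg hQ0 hδ]
  -- For large `δ` the trivial bound `‖u - v‖ ≤ 2` suffices.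
  · refine ⟨1, one_mem _, fun u v hu hv _ _ => ?_⟩
    have h3 : ‖u - Matrix.toEuclideanLin (1 : Matrix (Fin (p + 1)) (Fin (p + 1)) ℝ) v‖ ≤ 2 := by
      rw [Matrix.toLpLin_one]
      refine (norm_sub_le _ _).trans ?_
      simp only [LinearMap.id_apply]
      linarith
    have : 0 ≤ K * (p + 1) * δ := by positivity
    nlinarith

/-! ### The Frobenius norm and centralization -/

theorem frobNorm_eq_norm {d n : ℕ} (X : PointCloud d n) :
    frobNorm X = ‖(WithLp.toLp 2 X : PiLp 2 fun _ : Fin n => EuclideanSpace ℝ (Fin d))‖ := by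
  rw [PiLp.norm_eq_of_L2]; rfl

theorem frobNorm_nonneg {d n : ℕ} (X : PointCloud d n) : 0 ≤ frobNorm X := Real.sqrt_nonneg _

theorem norm_le_frobNorm {d n : ℕ} (X : PointCloud d n) (k : Fin n) : ‖X k‖ ≤ frobNorm X := by
  rw [frobNorm_eq_norm]
  exact PiLp.norm_apply_le (WithLp.toLp 2 X : PiLp 2 fun _ : Fin n => EuclideanSpace ℝ (Fin d)) k

theorem frobNorm_le_sum {d n : ℕ} (X : PointCloud d n) : frobNorm X ≤ ∑ k, ‖X k‖ := by
  rw [frobNorm_eq_norm]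
  exact norm_piLp_le_sum _

theorem frobNorm_le_of_norm_le {d n : ℕ} {X : PointCloud d n} {r : ℝ} (h : ∀ k, ‖X k‖ ≤ r) :
    frobNorm X ≤ n * r := by
  refine (frobNorm_le_sum X).trans ?_
  refine (Finset.sum_le_card_nsmul _ _ _ fun k _ => h k).trans ?_
  simp

theorem norm_mean_le {d n : ℕ} (X : PointCloud d n) : ‖mean X‖ ≤ frobNorm X := by
  rcases Nat.eq_zero_or_pos n with rfl | hn
  · simp [mean, frobNorm_nonneg]
  have hn' : (0 : ℝ) < n := by exact_mod_cast hn
  rw [mean, norm_smul, norm_inv, Real.norm_natCast, inv_mul_le_iff₀ hn']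
  refine (norm_sum_le _ _).trans ?_
  refine (Finset.sum_le_card_nsmul _ _ _ fun k _ => norm_le_frobNorm X k).trans ?_
  simp

theorem frobNorm_centralize_le {d n : ℕ} (X : PointCloud d n) :
    frobNorm (centralize X) ≤ n * (2 * frobNorm X) := by
  refine frobNorm_le_of_norm_le fun k => (norm_sub_le _ _).trans ?_
  linarith [norm_le_frobNorm X k, norm_mean_le X]

/-- The action of a permutation and a rotation, without translation. -/
noncomputable def rotPerm {d n : ℕ} (π : Equiv.Perm (Fin n)) (R : Matrix (Fin d) (Fin d) ℝ)
    (Y : PointCloud d n) : PointCloud d n := fun j => Matrix.toEuclideanLin R (Y (π j))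

theorem mean_act {d n : ℕ} (hn : 0 < n) (g : GPlus d n) (Y : PointCloud d n) :
    mean (g.act Y) = Matrix.toEuclideanLin (g.2.1 : Matrix (Fin d) (Fin d) ℝ) (mean Y) + g.2.2 := by
  have hn' : (n : ℝ) ≠ 0 := by exact_mod_cast hn.ne'
  simp only [mean, GPlus.act, Finset.sum_add_distrib, map_smul, map_sum, smul_add]
  rw [Equiv.sum_comp g.1 fun j => Matrix.toEuclideanLin (g.2.1 : Matrix (Fin d) (Fin d) ℝ) (Y j)]
  congr 1
  rw [Finset.sum_const, Finset.card_univ, Fintype.card_fin, ← Nat.cast_smul_eq_nsmul ℝ,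
    smul_smul, inv_mul_cancel₀ hn', one_smul]

theorem centralize_act {d n : ℕ} (g : GPlus d n) (Y : PointCloud d n) :
    centralize (g.act Y) = rotPerm g.1 (g.2.1 : Matrix (Fin d) (Fin d) ℝ) (centralize Y) := by
  funext j
  have hn : 0 < n := j.pos
  simp only [centralize, mean_act hn, rotPerm, GPlus.act, map_sub]
  abel

theorem centralize_sub {d n : ℕ} (X Y : PointCloud d n) :
    centralize (fun j => X j - Y j) = fun j => centralize X j - centralize Y j := by
  funext j
  simp only [centralize, mean, Finset.sum_sub_distrib, smul_sub]
  abel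

/-! ### Invariance of the features under rotations and permutations -/

theorem inner_toEuclideanLin_orthogonal {d : ℕ} {R : Matrix (Fin d) (Fin d) ℝ}
    (hR : R ∈ Matrix.specialOrthogonalGroup (Fin d) ℝ) (x y : EuclideanSpace ℝ (Fin d)) :
    inner ℝ (Matrix.toEuclideanLin R x) (Matrix.toEuclideanLin R y) = inner ℝ x y := by
  have h := (Matrix.mem_orthogonalGroup_iff' _ _).1 (Matrix.mem_specialOrthogonalGroup_iff.1 hR).1
  simp only [EuclideanSpace.inner_eq_star_dotProduct, star_trivial, Matrix.ofLp_toLpLin,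
    Matrix.toLin'_apply]
  rw [Matrix.dotProduct_mulVec, ← Matrix.mulVec_transpose, Matrix.mulVec_mulVec, h,
    Matrix.one_mulVec]

theorem norm_toEuclideanLin_orthogonal {d : ℕ} {R : Matrix (Fin d) (Fin d) ℝ}
    (hR : R ∈ Matrix.specialOrthogonalGroup (Fin d) ℝ) (x : EuclideanSpace ℝ (Fin d)) :
    ‖Matrix.toEuclideanLin R x‖ = ‖x‖ := by
  rw [norm_eq_sqrt_real_inner, inner_toEuclideanLin_orthogonal hR, ← norm_eq_sqrt_real_inner]

theorem det_colMatrix_toEuclideanLin {p : ℕ} (R : Matrix (Fin (p + 1)) (Fin (p + 1)) ℝ)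
    (v : Fin p → EuclideanSpace ℝ (Fin (p + 1))) (y : EuclideanSpace ℝ (Fin (p + 1))) :
    (colMatrix (fun a => Matrix.toEuclideanLin R (v a)) (Matrix.toEuclideanLin R y)).det =
      R.det * (colMatrix v y).det := by
  rw [← Matrix.det_mul]
  congr 1
  ext i j
  rw [Matrix.mul_apply]
  induction j using Fin.lastCases with
  | last => simp only [colMatrix_last]; simp [Matrix.mulVec, dotProduct]
  | cast a => simp only [colMatrix_castSucc]; simp [Matrix.mulVec, dotProduct]

theorem frobNorm_rotPerm {p n : ℕ} (π : Equiv.Perm (Fin n))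
    {R : Matrix (Fin (p + 1)) (Fin (p + 1)) ℝ}
    (hR : R ∈ Matrix.specialOrthogonalGroup (Fin (p + 1)) ℝ) (Y : PointCloud (p + 1) n) :
    frobNorm (rotPerm π R Y) = frobNorm Y := by
  simp only [frobNorm, rotPerm, norm_toEuclideanLin_orthogonal hR]
  rw [Equiv.sum_comp π fun j => ‖Y j‖ ^ 2]

theorem gram_rotPerm {p n : ℕ} (π : Equiv.Perm (Fin n))
    {R : Matrix (Fin (p + 1)) (Fin (p + 1)) ℝ}
    (hR : R ∈ Matrix.specialOrthogonalGroup (Fin (p + 1)) ℝ) (Y : PointCloud (p + 1) n)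
    (i : Tuples n p) :
    gram (rotPerm π R Y) i = gram Y (i.trans π.toEmbedding) := by
  funext a b
  simp only [gram, frobNorm_rotPerm π hR Y]
  simp only [rotPerm, norm_toEuclideanLin_orthogonal hR, inner_toEuclideanLin_orthogonal hR]
  rfl

theorem feature_rotPerm {p n : ℕ} (π : Equiv.Perm (Fin n))
    {R : Matrix (Fin (p + 1)) (Fin (p + 1)) ℝ}
    (hR : R ∈ Matrix.specialOrthogonalGroup (Fin (p + 1)) ℝ) (Y : PointCloud (p + 1) n)
    (i : Tuples n p) (k : Fin n) :
    feature (rotPerm π R Y) i k = feature Y (i.trans π.toEmbedding) (π k) := by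
  have h1 : inner ℝ (perp (rotPerm π R Y) i) (rotPerm π R Y k) =
      inner ℝ (perp Y (i.trans π.toEmbedding)) (Y (π k)) := by
    rw [perp, perp, inner_cross, inner_cross]
    simp only [rotPerm]
    rw [det_colMatrix_toEuclideanLin, (Matrix.mem_specialOrthogonalGroup_iff.1 hR).2, one_mul]
    rfl
  simp only [feature, h1, frobNorm_rotPerm π hR Y]
  simp only [rotPerm, norm_toEuclideanLin_orthogonal hR, inner_toEuclideanLin_orthogonal hR]
  rfl

theorem featureMultiset_rotPerm {p n : ℕ} (π : Equiv.Perm (Fin n))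
    {R : Matrix (Fin (p + 1)) (Fin (p + 1)) ℝ}
    (hR : R ∈ Matrix.specialOrthogonalGroup (Fin (p + 1)) ℝ) (Y : PointCloud (p + 1) n)
    (i : Tuples n p) :
    featureMultiset (rotPerm π R Y) i = featureMultiset Y (i.trans π.toEmbedding) := by
  have h : (Finset.univ.map (i.trans π.toEmbedding))ᶜ =
      ((Finset.univ.map i)ᶜ).map π.toEmbedding := by
    ext k
    simp only [Finset.mem_compl, Finset.mem_map, Finset.mem_univ, true_and,
      Function.Embedding.trans_apply, Equiv.coe_toEmbedding]
    constructor
    · intro hk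
      exact ⟨π.symm k, fun ⟨a, ha⟩ => hk ⟨a, by rw [ha, Equiv.apply_symm_apply]⟩, by simp⟩
    · rintro ⟨l, hl, rfl⟩ ⟨a, ha⟩
      exact hl ⟨a, π.injective ha⟩
  rw [featureMultiset, featureMultiset, h, Finset.map_val, Multiset.map_map]
  exact Multiset.map_congr rfl fun k _ => feature_rotPerm π hR Y i k

/-! ### The model in terms of enumerated multisets -/

/-- The increasing enumeration of the indices outside a tuple. -/
def complEmb {n p : ℕ} (i : Tuples n p) : Fin (n - p) ↪o Fin n :=
  Finset.orderEmbOfFin (Finset.univ.map i)ᶜ (by simp [Finset.card_compl])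

theorem featureMultiset_eq_multisetOf {p n : ℕ} (X : PointCloud (p + 1) n) (i : Tuples n p) :
    featureMultiset X i = multisetOf fun l => feature X i (complEmb i l) := by
  rw [featureMultiset, multisetOf, complEmb]
  conv_lhs => rw [← Finset.map_orderEmbOfFin_univ (Finset.univ.map i)ᶜ
    (by simp [Finset.card_compl] : _ = n - p), Finset.map_val, Multiset.map_map]
  rfl

/-- The vector `h_𝐢` of the model, as a function of a centralized point set. -/
noncomputable def tupleEmbedding {p n r : ℕ}
    (ψ : (Fin p → Fin p → ℝ) → Multiset (Fin (p + 2) → ℝ) → (Fin r → ℝ))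
    (X : PointCloud (p + 1) n) (i : Tuples n p) : Fin r → ℝ :=
  ψ (gram X i) (featureMultiset X i)

/-- The family of the vectors `h_𝐢`, with the tuples enumerated. -/
noncomputable def tupleFamily {p n r : ℕ}
    (ψ : (Fin p → Fin p → ℝ) → Multiset (Fin (p + 2) → ℝ) → (Fin r → ℝ))
    (X : PointCloud (p + 1) n) (t : Fin (Fintype.card (Tuples n p))) : Fin r → ℝ :=
  tupleEmbedding ψ X ((Fintype.equivFin (Tuples n p)).symm t)

theorem map_univ_val_comp_equiv {α β γ : Type*} [Fintype α] [Fintype β] (e : α ≃ β) (f : β → γ) :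
    (Finset.univ : Finset α).val.map (fun a => f (e a)) = (Finset.univ : Finset β).val.map f := by
  rw [← Finset.map_univ_equiv e, Finset.map_val, Multiset.map_map]
  rfl

theorem multisetOf_tupleFamily {p n r : ℕ}
    (ψ : (Fin p → Fin p → ℝ) → Multiset (Fin (p + 2) → ℝ) → (Fin r → ℝ))
    (X : PointCloud (p + 1) n) :
    multisetOf (tupleFamily ψ X) =
      (Finset.univ : Finset (Tuples n p)).val.map (tupleEmbedding ψ X) :=
  map_univ_val_comp_equiv (Fintype.equivFin (Tuples n p)).symm (tupleEmbedding ψ X)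

theorem multisetOf_tupleFamily_rotPerm {p n r : ℕ}
    (ψ : (Fin p → Fin p → ℝ) → Multiset (Fin (p + 2) → ℝ) → (Fin r → ℝ))
    (π : Equiv.Perm (Fin n)) {R : Matrix (Fin (p + 1)) (Fin (p + 1)) ℝ}
    (hR : R ∈ Matrix.specialOrthogonalGroup (Fin (p + 1)) ℝ) (Y : PointCloud (p + 1) n) :
    multisetOf (tupleFamily ψ (rotPerm π R Y)) = multisetOf (tupleFamily ψ Y) := by
  rw [multisetOf_tupleFamily, multisetOf_tupleFamily,
    ← map_univ_val_comp_equiv (Equiv.embeddingCongr (Equiv.refl (Fin p)) π)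
      (tupleEmbedding ψ Y)]
  refine Multiset.map_congr rfl fun i _ => ?_
  rw [tupleEmbedding, gram_rotPerm π hR, featureMultiset_rotPerm π hR]
  rfl

/-- At the zero point set all features vanish (there `0 / 0 = 0`), and a homogeneous `φ ∘ ψ`
vanishes as well, so the formula of the model also gives its value `0` at this point set. -/
theorem model_eq {p n r m : ℕ}
    {ψ : (Fin p → Fin p → ℝ) → Multiset (Fin (p + 2) → ℝ) → (Fin r → ℝ)}
    {φ : Multiset (Fin r → ℝ) → (Fin m → ℝ)}
    (hψ : HomogeneousUpdate (n - p) ψ)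
    (hφ : HomogeneousReadout (Fintype.card (Tuples n p)) φ) (X : PointCloud (p + 1) n) :
    model ψ φ X = WithLp.toLp 2 (φ (multisetOf (tupleFamily ψ (centralize X)))) := by
  rw [model]
  split_ifs with h
  · have h0 : tupleFamily ψ (centralize X) = 0 := by
      funext t
      have hg : ∀ i : Tuples n p, gram (0 : PointCloud (p + 1) n) i = 0 := by
        intro i; funext a b; simp [gram]
      have hf : ∀ i : Tuples n p, (fun l => feature (0 : PointCloud (p + 1) n) i (complEmb i l)) =
          0 := by
        intro i; funext l b
        induction b using Fin.lastCases with
        | last => simp [feature]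
        | cast b =>
          induction b using Fin.lastCases with
          | last => simp [feature]
          | cast b => simp [feature]
      have h2 := hψ 2 two_pos 0 0
      rw [smul_zero, smul_zero, two_smul] at h2
      rw [tupleFamily, tupleEmbedding, h, hg, featureMultiset_eq_multisetOf, hf]
      exact left_eq_add.1 h2
    have h2 := hφ 2 two_pos 0
    rw [smul_zero, two_smul] at h2
    rw [h0, left_eq_add.1 h2]
    rfl
  · congr 2
    exact (multisetOf_tupleFamily ψ (centralize X)).symm

theorem wassersteinInf_le {N q : ℕ} (x y : Fin N → (Fin q → ℝ)) :
    wassersteinInf x y ≤ ‖fun i => x i - y i‖ :=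
  ciInf_le (Set.finite_range _).bddBelow (1 : Equiv.Perm (Fin N))

theorem exists_perm_norm_eq_wassersteinInf {N q : ℕ} (x y : Fin N → (Fin q → ℝ)) :
    ∃ τ : Equiv.Perm (Fin N), ‖fun i => x i - y (τ i)‖ = wassersteinInf x y :=
  exists_eq_ciInf_of_finite

/-! ### Lipschitz continuity of the features -/

/-- The `1`-homogeneous extension of a `C¹` function on the unit sphere is globally Lipschitz. -/
theorem exists_lipschitz_homogeneous_extension {V : Type*} [NormedAddCommGroup V]
    [NormedSpace ℝ V] [FiniteDimensional ℝ V] {P : V → ℝ} (hP : ContDiff ℝ 1 P) :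
    ∃ L : ℝ, ∀ X Y : V,
      |‖X‖ * P (‖X‖⁻¹ • X) - ‖Y‖ * P (‖Y‖⁻¹ • Y)| ≤ L * ‖X - Y‖ := by
  have : ProperSpace V := FiniteDimensional.proper ℝ V
  obtain ⟨L, hL⟩ := hP.contDiffOn.exists_lipschitzOnWith one_ne_zero
    (convex_closedBall (0 : V) 1) (isCompact_closedBall _ _)
  obtain ⟨M, hM⟩ := (isCompact_closedBall (0 : V) 1).exists_bound_of_continuousOn
    hP.continuous.continuousOn
  have hball : ∀ X : V, ‖X‖⁻¹ • X ∈ Metric.closedBall (0 : V) 1 := by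
    intro X
    rw [mem_closedBall_zero_iff, norm_smul, norm_inv, norm_norm]
    exact inv_mul_le_one
  have hscale : ∀ X : V, ‖X‖ • (‖X‖⁻¹ • X) = X := by
    intro X
    rcases eq_or_ne X 0 with rfl | hX
    · simp
    · rw [smul_smul, mul_inv_cancel₀ (norm_ne_zero_iff.2 hX), one_smul]
  refine ⟨L * 2 + M, fun X Y => ?_⟩
  set U := ‖X‖⁻¹ • X with hU
  set W := ‖Y‖⁻¹ • Y with hW
  have hUW : ‖X‖ * ‖U - W‖ ≤ 2 * ‖X - Y‖ := by
    have h1 : ‖X‖ • (U - W) = (X - Y) + (‖Y‖ - ‖X‖) • W := by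
      rw [smul_sub, sub_smul, hscale X, hW, hscale Y, ← hW]
      abel
    have h2 : ‖(‖Y‖ - ‖X‖) • W‖ ≤ ‖X - Y‖ * 1 := by
      rw [norm_smul, Real.norm_eq_abs, abs_sub_comm]
      exact mul_le_mul (abs_norm_sub_norm_le X Y) (mem_closedBall_zero_iff.1 (hball Y))
        (norm_nonneg _) (norm_nonneg _)
    calc ‖X‖ * ‖U - W‖ = ‖‖X‖ • (U - W)‖ := by rw [norm_smul, norm_norm]
      _ ≤ _ := by rw [h1]; linarith [norm_add_le (X - Y) ((‖Y‖ - ‖X‖) • W)]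
  have h3 : |P U - P W| ≤ L * ‖U - W‖ := hL.norm_sub_le (hball X) (hball Y)
  have h4 : |P W| ≤ M := hM _ (hball Y)
  have h5 : ‖X‖ * P U - ‖Y‖ * P W = ‖X‖ * (P U - P W) + (‖X‖ - ‖Y‖) * P W := by ring
  rw [h5]
  refine (abs_add_le _ _).trans ?_
  rw [abs_mul, abs_mul, abs_norm]
  calc _ ≤ ‖X‖ * (L * ‖U - W‖) + ‖X - Y‖ * M := by
        gcongr
        exact abs_norm_sub_norm_le X Y
    _ = L * (‖X‖ * ‖U - W‖) + ‖X - Y‖ * M := by ring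
    _ ≤ L * (2 * ‖X - Y‖) + ‖X - Y‖ * M := by gcongr
    _ = _ := by ring

theorem exists_uniform_lipschitz {ι α : Type*} [Finite ι] (F : ι → α → ℝ) (D : α → ℝ)
    (hD : ∀ x, 0 ≤ D x) (h : ∀ i, ∃ L : ℝ, ∀ x, F i x ≤ L * D x) :
    ∃ L : ℝ, 0 ≤ L ∧ ∀ i x, F i x ≤ L * D x := by
  choose L hL using h
  obtain ⟨M, hM⟩ := (Set.finite_range L).bddAbove
  refine ⟨max M 0, le_max_right _ _, fun i x => (hL i x).trans ?_⟩
  exact mul_le_mul_of_nonneg_right ((hM ⟨i, rfl⟩).trans (le_max_left _ _)) (hD x)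

theorem colMatrix_smul {p : ℕ} (s : ℝ) (v : Fin p → EuclideanSpace ℝ (Fin (p + 1)))
    (y : EuclideanSpace ℝ (Fin (p + 1))) :
    colMatrix (fun a => s • v a) (s • y) = s • colMatrix v y := by
  ext i j
  induction j using Fin.lastCases with
  | last => simp only [colMatrix_last, Matrix.smul_apply]; rfl
  | cast a => simp only [colMatrix_castSucc, Matrix.smul_apply]; rfl

theorem inner_div_frobNorm {d n : ℕ} (X : PointCloud d n) (a b : Fin n) :
    inner ℝ (X a) (X b) / frobNorm X =
      frobNorm X * inner ℝ ((frobNorm X)⁻¹ • X a) ((frobNorm X)⁻¹ • X b) := by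
  rw [real_inner_smul_left, real_inner_smul_right]
  rcases eq_or_ne (frobNorm X) 0 with h | h
  · simp [h]
  · field_simp

theorem eq_zero_of_frobNorm_eq_zero {d n : ℕ} {X : PointCloud d n} (h : frobNorm X = 0) :
    X = 0 := by
  funext k
  exact norm_le_zero_iff.1 (h ▸ norm_le_frobNorm X k)

/-- The last quotient in the features is the `1`-homogeneous extension of a determinant. For
`frobNorm X = 0` both sides vanish, also in dimension one, where the exponent is `0`. -/
theorem inner_perp_div_frobNorm {p n : ℕ} (X : PointCloud (p + 1) n) (i : Tuples n p)
    (k : Fin n) :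
    inner ℝ (perp X i) (X k) / frobNorm X ^ p = frobNorm X *
      (colMatrix (fun a => (frobNorm X)⁻¹ • X (i a)) ((frobNorm X)⁻¹ • X k)).det := by
  rw [colMatrix_smul, Matrix.det_smul, Fintype.card_fin, perp, inner_cross]
  rcases eq_or_ne (frobNorm X) 0 with h | h
  · rw [← inner_cross, eq_zero_of_frobNorm_eq_zero h]
    simp [frobNorm]
  · rw [inv_pow, pow_succ]
    field_simp

theorem frobNorm_sub_eq_norm {d n : ℕ} (X Y : PointCloud d n) :
    frobNorm (fun j => X j - Y j) = ‖(WithLp.toLp 2 X - WithLp.toLp 2 Y :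
      PiLp 2 fun _ : Fin n => EuclideanSpace ℝ (Fin d))‖ :=
  frobNorm_eq_norm _

/-- All entries of the Gram matrices and of the features are globally Lipschitz, also at the zero point
set, where the quotients by the Frobenius norm are `0 / 0 = 0`. -/
theorem exists_lipschitz_gram_feature (p n : ℕ) : ∃ L : ℝ, 0 ≤ L ∧
    ∀ (X Y : PointCloud (p + 1) n) (i : Tuples n p),
      ‖gram X i - gram Y i‖ ≤ L * frobNorm (fun j => X j - Y j) ∧
      ∀ k, ‖feature X i k - feature Y i k‖ ≤ L * frobNorm (fun j => X j - Y j) := by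
  obtain ⟨L₁, hL₁0, hL₁⟩ := exists_uniform_lipschitz
    (fun (ab : Fin n × Fin n) (XY : PointCloud (p + 1) n × PointCloud (p + 1) n) =>
      |inner ℝ (XY.1 ab.1) (XY.1 ab.2) / frobNorm XY.1 -
        inner ℝ (XY.2 ab.1) (XY.2 ab.2) / frobNorm XY.2|)
    (fun XY => frobNorm (fun j => XY.1 j - XY.2 j)) (fun _ => frobNorm_nonneg _) (by
      rintro ⟨a, b⟩
      obtain ⟨L, hL⟩ := exists_lipschitz_homogeneous_extension
        (V := PiLp 2 fun _ : Fin n => EuclideanSpace ℝ (Fin (p + 1)))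
        (P := fun Z => inner ℝ (Z a) (Z b))
        (ContDiff.inner ℝ (by fun_prop) (by fun_prop))
      refine ⟨L, fun XY => ?_⟩
      have := hL (WithLp.toLp 2 XY.1) (WithLp.toLp 2 XY.2)
      rw [← frobNorm_eq_norm, ← frobNorm_eq_norm, ← frobNorm_sub_eq_norm] at this
      rw [inner_div_frobNorm, inner_div_frobNorm]
      exact this)
  obtain ⟨L₂, hL₂0, hL₂⟩ := exists_uniform_lipschitz
    (fun (ik : Tuples n p × Fin n) (XY : PointCloud (p + 1) n × PointCloud (p + 1) n) =>
      |inner ℝ (perp XY.1 ik.1) (XY.1 ik.2) / frobNorm XY.1 ^ p -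
        inner ℝ (perp XY.2 ik.1) (XY.2 ik.2) / frobNorm XY.2 ^ p|)
    (fun XY => frobNorm (fun j => XY.1 j - XY.2 j)) (fun _ => frobNorm_nonneg _) (by
      rintro ⟨i, k⟩
      obtain ⟨L, hL⟩ := exists_lipschitz_homogeneous_extension
        (V := PiLp 2 fun _ : Fin n => EuclideanSpace ℝ (Fin (p + 1)))
        (P := fun Z => (colMatrix (fun a => Z (i a)) (Z k)).det)
        (contDiff_det (contDiff_colMatrix_apply (fun a => by fun_prop) (by fun_prop)))
      refine ⟨L, fun XY => ?_⟩
      have := hL (WithLp.toLp 2 XY.1) (WithLp.toLp 2 XY.2)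
      rw [← frobNorm_eq_norm, ← frobNorm_eq_norm, ← frobNorm_sub_eq_norm] at this
      rw [inner_perp_div_frobNorm, inner_perp_div_frobNorm]
      exact this)
  refine ⟨L₁ + L₂ + 1, by positivity, fun X Y i => ?_⟩
  set D := frobNorm (fun j => X j - Y j) with hD
  have hD0 : 0 ≤ D := frobNorm_nonneg _
  have h0 : 0 ≤ (L₁ + L₂ + 1) * D := by positivity
  have h1 : ∀ a b, |inner ℝ (X a) (X b) / frobNorm X - inner ℝ (Y a) (Y b) / frobNorm Y| ≤
      (L₁ + L₂ + 1) * D := fun a b =>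
    (hL₁ (a, b) (X, Y)).trans (mul_le_mul_of_nonneg_right (by linarith) hD0)
  have h2 : ∀ k, |inner ℝ (perp X i) (X k) / frobNorm X ^ p -
      inner ℝ (perp Y i) (Y k) / frobNorm Y ^ p| ≤ (L₁ + L₂ + 1) * D := fun k =>
    (hL₂ (i, k) (X, Y)).trans (mul_le_mul_of_nonneg_right (by linarith) hD0)
  have h3 : ∀ k, |‖X k‖ - ‖Y k‖| ≤ (L₁ + L₂ + 1) * D := by
    intro k
    refine (abs_norm_sub_norm_le _ _).trans ?_
    have := norm_le_frobNorm (fun j => X j - Y j) k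
    nlinarith
  refine ⟨?_, fun k => ?_⟩
  · rw [pi_norm_le_iff_of_nonneg h0]
    intro a
    rw [pi_norm_le_iff_of_nonneg h0]
    intro b
    simp only [Pi.sub_apply, gram, Real.norm_eq_abs]
    split_ifs
    · exact h3 _
    · exact h1 _ _
  · rw [pi_norm_le_iff_of_nonneg h0]
    intro b
    rw [Pi.sub_apply, Real.norm_eq_abs]
    induction b using Fin.lastCases with
    | last => simpa [feature] using h3 k
    | cast b =>
      induction b using Fin.lastCases with
      | last => simpa [feature] using h2 k
      | cast b => simpa [feature] using h1 (i b) k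

theorem norm_toLp_le {m : ℕ} (w : Fin m → ℝ) :
    ‖(WithLp.toLp 2 w : EuclideanSpace ℝ (Fin m))‖ ≤ m * ‖w‖ := by
  refine (norm_piLp_le_sum _).trans ?_
  refine (Finset.sum_le_card_nsmul _ _ _ fun k _ => norm_le_pi_norm w k).trans ?_
  simp

theorem norm_le_norm_toLp {m : ℕ} (w : Fin m → ℝ) :
    ‖w‖ ≤ ‖(WithLp.toLp 2 w : EuclideanSpace ℝ (Fin m))‖ := by
  rw [pi_norm_le_iff_of_nonneg (norm_nonneg _)]
  exact fun k => PiLp.norm_apply_le (WithLp.toLp 2 w : EuclideanSpace ℝ (Fin m)) k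

/-- The model is Lipschitz on all point sets. -/
theorem exists_model_lipschitz {p n r m : ℕ}
    {ψ : (Fin p → Fin p → ℝ) → Multiset (Fin (p + 2) → ℝ) → (Fin r → ℝ)}
    {φ : Multiset (Fin r → ℝ) → (Fin m → ℝ)}
    (hψ_hom : HomogeneousUpdate (n - p) ψ) (hψ_lip : BiLipschitzUpdate (n - p) ψ)
    (hφ_hom : HomogeneousReadout (Fintype.card (Tuples n p)) φ)
    (hφ_lip : BiLipschitzReadout (Fintype.card (Tuples n p)) φ) :
    ∃ C : ℝ, 0 < C ∧ ∀ X Y : PointCloud (p + 1) n,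
      ‖model ψ φ X - model ψ φ Y‖ ≤ C * dGPlus X Y := by
  obtain ⟨cψ, Cψ, hcψ, hcCψ, hψ⟩ := hψ_lip
  obtain ⟨cφ, Cφ, hcφ, hcCφ, hφ⟩ := hφ_lip
  obtain ⟨L, hL0, hL⟩ := exists_lipschitz_gram_feature p n
  have hCψ : 0 < Cψ := hcψ.trans_le hcCψ
  have hCφ : 0 < Cφ := hcφ.trans_le hcCφ
  -- The factor `n * 2` comes from centralization, the factor `m` from the Euclidean norm on `ℝ^m`.
  set C := m * (Cφ * (Cψ * (L * (n * 2)))) with hC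
  have hC0 : 0 ≤ C := by positivity
  have key : ∀ (X Y : PointCloud (p + 1) n) (g : GPlus (p + 1) n),
      ‖model ψ φ X - model ψ φ Y‖ ≤ C * frobNorm (fun j => X j - g.act Y j) := by
    intro X Y g
    set Z := centralize (g.act Y) with hZ
    have hYZ : multisetOf (tupleFamily ψ (centralize Y)) = multisetOf (tupleFamily ψ Z) := by
      rw [hZ, centralize_act, multisetOf_tupleFamily_rotPerm ψ g.1 g.2.1.2]
    set D := frobNorm (fun j => centralize X j - Z j) with hD
    have hD0 : 0 ≤ D := frobNorm_nonneg _
    have hDle : D ≤ n * (2 * frobNorm (fun j => X j - g.act Y j)) := by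
      rw [hD, hZ, ← centralize_sub]
      exact frobNorm_centralize_le _
    have h1 : ∀ t, ‖tupleFamily ψ (centralize X) t - tupleFamily ψ Z t‖ ≤ Cψ * (L * D) := by
      intro t
      simp only [tupleFamily, tupleEmbedding, featureMultiset_eq_multisetOf]
      refine (hψ _ _ _ _).2.trans ?_
      gcongr
      refine max_le (hL _ _ _).1 ((wassersteinInf_le _ _).trans ?_)
      rw [pi_norm_le_iff_of_nonneg (by positivity)]
      exact fun l => (hL _ _ _).2 _
    have h2 : wassersteinInf (tupleFamily ψ (centralize X)) (tupleFamily ψ Z) ≤ Cψ * (L * D) := by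
      refine (wassersteinInf_le _ _).trans ?_
      rw [pi_norm_le_iff_of_nonneg (by positivity)]
      exact h1
    rw [model_eq hψ_hom hφ_hom, model_eq hψ_hom hφ_hom, hYZ, ← WithLp.toLp_sub]
    calc _ ≤ m * (Cφ * (Cψ * (L * D))) := by
          refine (norm_toLp_le _).trans ?_
          gcongr
          refine (hφ _ _).2.trans ?_
          gcongr
      _ ≤ m * (Cφ * (Cψ * (L * (n * (2 * frobNorm (fun j => X j - g.act Y j)))))) := by gcongr
      _ = _ := by rw [hC]; ring
  refine ⟨C + 1, by positivity, fun X Y => ?_⟩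
  rw [dGPlus, Real.mul_iInf_of_nonneg (by positivity)]
  refine le_ciInf fun g => (key X Y g).trans ?_
  have := frobNorm_nonneg (fun j => X j - g.act Y j)
  nlinarith

/-! ### Alignment of point sets with close features -/

theorem abs_frobNorm_sub_le {d n : ℕ} {X Y : PointCloud d n} {ε : ℝ}
    (h : ∀ k, |‖X k‖ - ‖Y k‖| ≤ ε) : |frobNorm X - frobNorm Y| ≤ n * ε := by
  have h1 : ∀ Z : PointCloud d n,
      frobNorm Z = ‖(WithLp.toLp 2 fun k => ‖Z k‖ : EuclideanSpace ℝ (Fin n))‖ := by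
    intro Z
    simp [EuclideanSpace.norm_eq, frobNorm]
  rw [h1, h1]
  refine (abs_norm_sub_norm_le _ _).trans ((norm_piLp_le_sum _).trans ?_)
  refine (Finset.sum_le_card_nsmul _ _ ε fun k _ => ?_).trans ?_
  · exact h k
  · simp

theorem cross_smul {p : ℕ} {s : ℝ} (hs : s ≠ 0) (v : Fin p → EuclideanSpace ℝ (Fin (p + 1))) :
    cross (fun a => s • v a) = s ^ p • cross v := by
  refine ext_inner_right ℝ fun y => mul_left_cancel₀ hs ?_
  -- Scaling the last column as well makes the determinant homogeneous of degree `p + 1`.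
  rw [← real_inner_smul_right, inner_cross, colMatrix_smul, Matrix.det_smul, Fintype.card_fin,
    ← inner_cross, real_inner_smul_left, pow_succ]
  ring

/-- If two point sets have close features at a tuple whose cross product is large in `X`, then a
single rotation aligns them up to an error proportional to the distance of the features. -/
theorem exists_rotation_of_feature_close (p n : ℕ) {c : ℝ} (hc : 0 < c) : ∃ C : ℝ, 0 ≤ C ∧
    ∀ (X Y : PointCloud (p + 1) n) (i : Tuples n p) (ε : ℝ), 0 ≤ ε →
      c * frobNorm X ^ p ≤ ‖perp X i‖ →
      (∀ k, |‖X k‖ - ‖Y k‖| ≤ ε) →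
      (∀ a k, i a ≠ k →
        |inner ℝ (X (i a)) (X k) / frobNorm X - inner ℝ (Y (i a)) (Y k) / frobNorm Y| ≤ ε) →
      (∀ k, |inner ℝ (perp X i) (X k) / frobNorm X ^ p -
        inner ℝ (perp Y i) (Y k) / frobNorm Y ^ p| ≤ ε) →
      ∃ R ∈ Matrix.specialOrthogonalGroup (Fin (p + 1)) ℝ,
        ∀ k, ‖X k - Matrix.toEuclideanLin R (Y k)‖ ≤ C * ε := by
  obtain ⟨C, hC0, hC⟩ := exists_rotation_of_inner_close p hc
  obtain ⟨M, hM0, hM⟩ := exists_norm_cross_le p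
  set B : ℝ := 2 * (1 + n) + (1 + n * M) with hB
  have hB0 : 0 ≤ B := by positivity
  refine ⟨C * B + n + 1, by positivity, fun X Y i ε hε hXc h1 h2 h3 => ?_⟩
  set s := frobNorm X with hs
  set t := frobNorm Y with ht
  have hs0 : 0 ≤ s := frobNorm_nonneg _
  have ht0 : 0 ≤ t := frobNorm_nonneg _
  have hst : |t - s| ≤ n * ε := by rw [abs_sub_comm]; exact abs_frobNorm_sub_le h1
  -- If one of the point sets is `0`, the norms alone show that the other one is small.
  by_cases hz : s = 0 ∨ t = 0
  · refine ⟨1, one_mem _, fun k => ?_⟩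
    have hk := h1 k
    have hle : ε ≤ (C * B + n + 1) * ε := by
      have : 0 ≤ (C * B + n) * ε := by positivity
      linarith
    refine le_trans ?_ hle
    rw [Matrix.toLpLin_one, LinearMap.id_apply]
    rcases hz with hz | hz
    · simpa [eq_zero_of_frobNorm_eq_zero hz] using hk
    · simpa [eq_zero_of_frobNorm_eq_zero hz] using hk
  have hsp : 0 < s := lt_of_le_of_ne hs0 fun h => hz (Or.inl h.symm)
  have htp : 0 < t := lt_of_le_of_ne ht0 fun h => hz (Or.inr h.symm)
  set u : Fin n → EuclideanSpace ℝ (Fin (p + 1)) := fun k => s⁻¹ • X k with hu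
  set v : Fin n → EuclideanSpace ℝ (Fin (p + 1)) := fun k => t⁻¹ • Y k with hv
  have hnu : ∀ k, s * ‖u k‖ = ‖X k‖ := by
    intro k
    rw [hu, norm_smul, norm_inv, Real.norm_of_nonneg hs0, mul_inv_cancel_left₀ hsp.ne']
  have hnv : ∀ k, t * ‖v k‖ = ‖Y k‖ := by
    intro k
    rw [hv, norm_smul, norm_inv, Real.norm_of_nonneg ht0, mul_inv_cancel_left₀ htp.ne']
  have hu1 : ∀ k, ‖u k‖ ≤ 1 := fun k =>
    le_of_mul_le_mul_left (by rw [hnu, mul_one]; exact norm_le_frobNorm X k) hsp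
  have hv1 : ∀ k, ‖v k‖ ≤ 1 := fun k =>
    le_of_mul_le_mul_left (by rw [hnv, mul_one]; exact norm_le_frobNorm Y k) htp
  have hXu : ∀ a k, inner ℝ (X a) (X k) / s = s * inner ℝ (u a) (u k) := fun a k =>
    inner_div_frobNorm X a k
  have hYv : ∀ a k, inner ℝ (Y a) (Y k) / t = t * inner ℝ (v a) (v k) := fun a k =>
    inner_div_frobNorm Y a k
  have hXp : ∀ k, inner ℝ (perp X i) (X k) / s ^ p = s * inner ℝ (cross fun a => u (i a)) (u k) :=
    fun k => by rw [inner_cross]; exact inner_perp_div_frobNorm X i k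
  have hYp : ∀ k, inner ℝ (perp Y i) (Y k) / t ^ p = t * inner ℝ (cross fun a => v (i a)) (v k) :=
    fun k => by rw [inner_cross]; exact inner_perp_div_frobNorm Y i k
  -- Replacing the scale `t` by `s` in front of a bounded quantity costs at most `|t - s|`.
  have hscale : ∀ α β N : ℝ, |s * α - t * β| ≤ ε → |β| ≤ N → |s * (α - β)| ≤ (1 + n * N) * ε := by
    intro α β N h hβ
    have e : s * (α - β) = (s * α - t * β) + (t - s) * β := by ring
    rw [e]
    refine (abs_add_le _ _).trans ?_
    rw [abs_mul]
    have : |t - s| * |β| ≤ n * ε * N := mul_le_mul hst hβ (abs_nonneg _) (by positivity)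
    linarith
  have hdiv : ∀ α, |s * α| ≤ B * ε → |α| ≤ B * ε / s := by
    intro α h
    rw [abs_mul, abs_of_pos hsp] at h
    rw [le_div_iff₀ hsp]
    linarith
  have hin : ∀ a k, |inner ℝ (u (i a)) (u k) - inner ℝ (v (i a)) (v k)| ≤ B * ε / s := by
    intro a k
    apply hdiv
    have hnM : 0 ≤ n * M * ε := by positivity
    have hnε : 0 ≤ n * ε := by positivity
    -- The Gram matrix carries norms on its diagonal; squared norms are recovered from them.
    by_cases hk : i a = k
    · subst hk
      have e1 := h1 (i a)
      rw [← hnu, ← hnv] at e1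
      have e2 := hscale _ _ 1 e1 (by rw [abs_norm]; exact hv1 _)
      have e3 : s * (inner ℝ (u (i a)) (u (i a)) - inner ℝ (v (i a)) (v (i a))) =
          s * (‖u (i a)‖ - ‖v (i a)‖) * (‖u (i a)‖ + ‖v (i a)‖) := by
        rw [real_inner_self_eq_norm_sq, real_inner_self_eq_norm_sq]
        ring
      have e4 : |‖u (i a)‖ + ‖v (i a)‖| ≤ 2 := by
        rw [abs_of_nonneg (by positivity)]
        linarith [hu1 (i a), hv1 (i a)]
      rw [e3, abs_mul]
      calc _ ≤ (1 + n * 1) * ε * 2 := mul_le_mul e2 e4 (abs_nonneg _) (by positivity)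
        _ ≤ B * ε := by rw [hB]; linarith
    · have e1 := h2 a k hk
      rw [hXu, hYv] at e1
      have e2 := hscale _ _ 1 e1 (abs_inner_le_one (hv1 _) (hv1 _))
      refine e2.trans ?_
      rw [hB]; linarith
  have hcr : ∀ k, |inner ℝ (cross fun a => u (i a)) (u k) -
      inner ℝ (cross fun a => v (i a)) (v k)| ≤ B * ε / s := by
    intro k
    apply hdiv
    have e1 := h3 k
    rw [hXp, hYp] at e1
    have e2 := hscale _ _ M e1 (by
      refine (abs_real_inner_le_norm _ _).trans ?_
      calc _ ≤ M * 1 := mul_le_mul (hM _ fun a => hv1 _) (hv1 k) (norm_nonneg _) hM0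
        _ = M := mul_one M)
    refine e2.trans ?_
    have hnε : 0 ≤ n * ε := by positivity
    rw [hB]; linarith
  have hcu : c ≤ ‖cross fun a => u (i a)‖ := by
    rw [hu, cross_smul (inv_ne_zero hsp.ne'), norm_smul, norm_pow, norm_inv,
      Real.norm_of_nonneg hs0, inv_pow, le_inv_mul_iff₀ (by positivity), mul_comm]
    exact hXc
  obtain ⟨R, hR, hRuv⟩ := hC (fun a => u (i a)) (fun a => v (i a)) (B * ε / s) (by positivity)
    (fun a => hu1 _) (fun a => hv1 _) hcu (fun a b => hin a (i b))
  refine ⟨R, hR, fun k => ?_⟩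
  have e1 := hRuv (u k) (v k) (hu1 k) (hv1 k) (fun a => hin a k) (hcr k)
  have e2 : X k - Matrix.toEuclideanLin R (Y k) =
      s • (u k - Matrix.toEuclideanLin R (v k)) + (s - t) • Matrix.toEuclideanLin R (v k) := by
    have e3 : X k = s • u k := by rw [hu, smul_smul, mul_inv_cancel₀ hsp.ne', one_smul]
    have e4 : Y k = t • v k := by rw [hv, smul_smul, mul_inv_cancel₀ htp.ne', one_smul]
    rw [e3, e4, map_smul, smul_sub, sub_smul]
    abel
  rw [e2]
  refine (norm_add_le _ _).trans ?_
  rw [norm_smul, norm_smul, norm_toEuclideanLin_orthogonal hR, Real.norm_of_nonneg hs0,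
    Real.norm_eq_abs, abs_sub_comm]
  calc _ ≤ s * (C * (B * ε / s)) + n * ε * 1 := by
        gcongr
        exact hv1 k
    _ = (C * B + n) * ε := by field_simp
    _ ≤ _ := by linarith

/-- The positions of a tuple, together with the enumeration of the other indices. -/
noncomputable def tupleSumEquiv {n p : ℕ} (i : Tuples n p) : Fin p ⊕ Fin (n - p) ≃ Fin n :=
  Equiv.ofBijective (Sum.elim i (complEmb i)) <| by
    have hr : Set.range (complEmb i) = ((Finset.univ.map i)ᶜ : Finset (Fin n)) :=
      Finset.range_orderEmbOfFin _ _
    constructor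
    · refine i.injective.sumElim (complEmb i).injective fun a l h => ?_
      have : complEmb i l ∈ Set.range (complEmb i) := ⟨l, rfl⟩
      rw [hr, ← h] at this
      simp at this
    · intro k
      by_cases hk : k ∈ Finset.univ.map i
      · obtain ⟨a, -, ha⟩ := Finset.mem_map.1 hk
        exact ⟨Sum.inl a, ha⟩
      · have : k ∈ Set.range (complEmb i) := by rw [hr]; simpa using hk
        obtain ⟨l, hl⟩ := this
        exact ⟨Sum.inr l, hl⟩

theorem forall_iff_tuple_compl {n p : ℕ} (i : Tuples n p) {P : Fin n → Prop} :
    (∀ k, P k) ↔ (∀ a, P (i a)) ∧ ∀ l, P (complEmb i l) := by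
  rw [← (tupleSumEquiv i).forall_congr_right, Sum.forall]
  rfl

theorem exists_perm_extending {n p : ℕ} (i j : Tuples n p) (τ : Equiv.Perm (Fin (n - p))) :
    ∃ π : Equiv.Perm (Fin n), (∀ a, π (i a) = j a) ∧
      ∀ l, π (complEmb i l) = complEmb j (τ l) := by
  refine ⟨(tupleSumEquiv i).symm.trans
    ((Equiv.sumCongr (Equiv.refl _) τ).trans (tupleSumEquiv j)), fun a => ?_, fun l => ?_⟩
  · have : i a = tupleSumEquiv i (Sum.inl a) := rfl
    rw [this, Equiv.trans_apply, Equiv.symm_apply_apply]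
    rfl
  · have : complEmb i l = tupleSumEquiv i (Sum.inr l) := rfl
    rw [this, Equiv.trans_apply, Equiv.symm_apply_apply]
    rfl

/-- The model is bounded below by the matching metric as soon as one of the two point sets is
nondegenerate. -/
theorem exists_model_lower_lipschitz {p n r m : ℕ} (hn : p ≤ n) {c : ℝ} (hc : 0 < c)
    {ψ : (Fin p → Fin p → ℝ) → Multiset (Fin (p + 2) → ℝ) → (Fin r → ℝ)}
    {φ : Multiset (Fin r → ℝ) → (Fin m → ℝ)}
    (hψ_hom : HomogeneousUpdate (n - p) ψ) (hψ_lip : BiLipschitzUpdate (n - p) ψ)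
    (hφ_hom : HomogeneousReadout (Fintype.card (Tuples n p)) φ)
    (hφ_lip : BiLipschitzReadout (Fintype.card (Tuples n p)) φ) :
    ∃ C : ℝ, 0 < C ∧ ∀ X Y : PointCloud (p + 1) n, centralize X ∈ Omega c →
      C * dGPlus X Y ≤ ‖model ψ φ X - model ψ φ Y‖ := by
  obtain ⟨cψ, Cψ, hcψ, -, hψ⟩ := hψ_lip
  obtain ⟨cφ, Cφ, hcφ, -, hφ⟩ := hφ_lip
  obtain ⟨K, hK0, hK⟩ := exists_rotation_of_feature_close p n hc
  have : Nonempty (Tuples n p) := ⟨Fin.castLEEmb hn⟩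
  refine ⟨(n * K * (cφ * cψ)⁻¹ + 1)⁻¹, by positivity, fun X Y hX => ?_⟩
  set E := ‖model ψ φ X - model ψ φ Y‖ with hE
  have hE0 : 0 ≤ E := norm_nonneg _
  set ε := (cφ * cψ)⁻¹ * E with hε
  have hε0 : 0 ≤ ε := by positivity
  set X' := centralize X with hX'
  set Y' := centralize Y with hY'
  obtain ⟨i, hi⟩ := exists_eq_ciSup_of_finite (f := fun i : Tuples n p => ‖perp X' i‖)
  have hiX : c * frobNorm X' ^ p ≤ ‖perp X' i‖ := by rw [hi]; exact hX.2
  -- The tuple `j` of `Y` matched with `i`.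
  obtain ⟨j, hj⟩ : ∃ j : Tuples n p,
      cφ * ‖tupleEmbedding ψ X' i - tupleEmbedding ψ Y' j‖ ≤ E := by
    obtain ⟨τ, hτ⟩ := exists_perm_norm_eq_wassersteinInf (tupleFamily ψ X') (tupleFamily ψ Y')
    set e := Fintype.equivFin (Tuples n p)
    refine ⟨e.symm (τ (e i)), ?_⟩
    have h1 := (hφ (tupleFamily ψ X') (tupleFamily ψ Y')).1
    rw [← hτ] at h1
    have h2 := norm_le_pi_norm (fun t => tupleFamily ψ X' t - tupleFamily ψ Y' (τ t)) (e i)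
    have h3 : tupleFamily ψ X' (e i) = tupleEmbedding ψ X' i := by
      simp [tupleFamily, e]
    rw [h3] at h2
    calc _ ≤ _ := mul_le_mul_of_nonneg_left h2 hcφ.le
      _ ≤ _ := h1
      _ ≤ E := by
        rw [hE, model_eq hψ_hom hφ_hom, model_eq hψ_hom hφ_hom, ← WithLp.toLp_sub]
        exact norm_le_norm_toLp _
  -- The permutation of the points that matches the features at `i` and `j`.
  obtain ⟨τ, hτ⟩ := exists_perm_norm_eq_wassersteinInf
    (fun l => feature X' i (complEmb i l)) (fun l => feature Y' j (complEmb j l))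
  have hmax : max ‖gram X' i - gram Y' j‖
      ‖fun l => feature X' i (complEmb i l) - feature Y' j (complEmb j (τ l))‖ ≤ ε := by
    rw [hτ]
    have h1 := (hψ (gram X' i) (gram Y' j) (fun l => feature X' i (complEmb i l))
      (fun l => feature Y' j (complEmb j l))).1
    rw [← featureMultiset_eq_multisetOf, ← featureMultiset_eq_multisetOf] at h1
    rw [hε, le_inv_mul_iff₀ (by positivity), mul_assoc]
    exact (mul_le_mul_of_nonneg_left h1 hcφ.le).trans hj
  obtain ⟨π, hπi, hπl⟩ := exists_perm_extending i j τ
  set Z : PointCloud (p + 1) n := fun k => Y' (π k) with hZ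
  have hZf : frobNorm Z = frobNorm Y' := by
    rw [frobNorm, frobNorm, hZ, Equiv.sum_comp π fun k => ‖Y' k‖ ^ 2]
  have hZp : perp Z i = perp Y' j := by
    simp only [perp, hZ, hπi]
  have hgram : ∀ a b, |gram X' i a b - gram Y' j a b| ≤ ε := fun a b =>
    ((norm_le_pi_norm ((gram X' i - gram Y' j) a) b).trans
      (norm_le_pi_norm (gram X' i - gram Y' j) a)).trans ((le_max_left _ _).trans hmax)
  have hfeat : ∀ l b, |feature X' i (complEmb i l) b - feature Y' j (complEmb j (τ l)) b| ≤ ε :=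
    fun l b => ((norm_le_pi_norm (feature X' i (complEmb i l) -
      feature Y' j (complEmb j (τ l))) b).trans (norm_le_pi_norm (fun l =>
        feature X' i (complEmb i l) - feature Y' j (complEmb j (τ l))) l)).trans
      ((le_max_right _ _).trans hmax)
  obtain ⟨R, hR, hRk⟩ := hK X' Z i ε hε0 hiX
    ((forall_iff_tuple_compl i).2 ⟨fun a => by simpa [gram, hZ, hπi] using hgram a a,
      fun l => by simpa [feature, hZ, hπl] using hfeat l (Fin.last _)⟩)
    (fun a => (forall_iff_tuple_compl i).2 ⟨fun b hab => by
        have hab' : a ≠ b := fun h => hab (by rw [h])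
        rw [hZf]
        simpa [gram, hZ, hπi, hab'] using hgram a b,
      fun l _ => by
        rw [hZf]
        simpa [feature, hZ, hπi, hπl] using hfeat l a.castSucc.castSucc⟩)
    ((forall_iff_tuple_compl i).2 ⟨fun a => by
        rw [perp, perp, inner_cross_self_right (fun a => X' (i a)) a,
          inner_cross_self_right (fun a => Z (i a)) a]
        simpa using hε0,
      fun l => by
        rw [hZf, hZp]
        simpa [feature, hZ, hπl] using hfeat l (Fin.last p).castSucc⟩)
  have hdist : dGPlus X Y ≤ n * (K * ε) := by
    refine (ciInf_le ⟨0, ?_⟩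
      (π, ⟨R, hR⟩, mean X - Matrix.toEuclideanLin R (mean Y))).trans ?_
    · rintro _ ⟨g, rfl⟩
      exact frobNorm_nonneg _
    · refine frobNorm_le_of_norm_le fun k => ?_
      convert hRk k using 2
      simp only [GPlus.act, hZ, hX', hY', centralize, map_sub]
      abel
  rw [inv_mul_le_iff₀ (by positivity)]
  calc _ ≤ n * (K * ε) := hdist
    _ = n * K * (cφ * cψ)⁻¹ * E := by rw [hε]; ring
    _ ≤ _ := by linarith

end PointSet

theorem mainTheorem1 (p n : ℕ) (hn : p + 1 ≤ n) (c : ℝ) (hc : 0 < c) (r m : ℕ)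
    (ψ : (Fin p → Fin p → ℝ) → Multiset (Fin (p + 2) → ℝ) → (Fin r → ℝ))
    (φ : Multiset (Fin r → ℝ) → (Fin m → ℝ))
    (hψ_hom : PointSet.HomogeneousUpdate (n - p) ψ)
    (hψ_lip : PointSet.BiLipschitzUpdate (n - p) ψ)
    (hφ_hom : PointSet.HomogeneousReadout (Fintype.card (PointSet.Tuples n p)) φ)
    (hφ_lip : PointSet.BiLipschitzReadout (Fintype.card (PointSet.Tuples n p)) φ) :
    PointSet.BiLipschitzOnWrt
      (PointSet.model ψ φ : PointSet.PointCloud (p + 1) n → EuclideanSpace ℝ (Fin m))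
      PointSet.dGPlus
      {X | PointSet.centralize X ∈ PointSet.Omega c} := by
  obtain ⟨C, hC0, hC⟩ := PointSet.exists_model_lipschitz hψ_hom hψ_lip hφ_hom hφ_lip
  obtain ⟨c', hc'0, hc'⟩ := PointSet.exists_model_lower_lipschitz (Nat.le_of_succ_le hn) hc
    hψ_hom hψ_lip hφ_hom hφ_lip
  exact ⟨⟨C, hC0, fun X _ Y _ => hC X Y⟩, ⟨c', hc'0, fun X hX Y _ => hc' X Y hX⟩⟩
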